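/- **Setting.** Let $\mathcal S,\mathcal A$ be finite sets with $|\mathcal S|,|\mathcal A|>1$, let $\gamma\in(0,1)$, let $\nu_0$ be a probability vector on $\mathcal S$, and let $h:\mathcal X\to\mathbb R$ be strictly convex on a closed convex set $\mathcal X\subseteq\mathbb R^{\mathcal A}$ with $\operatorname{relint}\Delta_{\mathcal A}\subseteq\operatorname{int}\mathcal X$, where $\Delta_{\mathcal A}$ is the probability simplex over $\mathcal A$. For a transition law $P$ (a probability vector $P(\cdot\mid s,a)$ on $\mathcal S$ for each $(s,a)$) let $(E-\gamma P):\mathbb R^{\mathcal S}\to\mathbb R^{\mathcal S\times\mathcal A}$, $((E-\gamma P)v)(s,a)=v(s)-\gamma\sum_{s'}P(s'\mid s,a)v(s')$, let $\mathcal U_P=\operatorname{im}(E-\gamma P)$, and let $$\mathcal M_P=\{\mu\in\mathbb R_{\ge 0}^{\mathcal S\times\mathcal A}:(E-\gamma P)^\top\mu=(1-\gamma)\nu_0\}.$$ For $\mu\in\mathcal M_P$ put $\nu(s)=\sum_a\mu(s,a)$, $\pi^\mu(a\mid s)=\mu(s,a)/\nu(s)$ (uniform in $a$ if $\nu(s)=0$),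 $\bar h(\mu)=\sum_{s,a}\mu(s,a)\,h(\pi^\mu(\cdot\mid s))$. For a reward $r\in\mathbb R^{\mathcal S\times\mathcal A}$ put $J(r,\mu)=\langle r,\mu\rangle-\bar h(\mu)$, $\mathsf{RL}_P(r)=\arg\max_{\mu\in\mathcal M_P}J(r,\mu)$ and $\mathsf{SubOpt}_P(r,\mu)=\max_{\mu'\in\mathcal M_P}J(r,\mu')-J(r,\mu)$. The principal angles $\theta_i(\mathcal V,\mathcal W)\in[0,\pi/2]$, $i=1,\dots,m$, of two $m$-dimensional subspaces are defined recursively: $\cos\theta_i$ is the maximum of $\langle v,w\rangle$ over unit vectors $v\in\mathcal V$, $w\in\mathcal W$ with $\langle v,v_j\rangle=\langle w,w_j\rangle=0$ for $j<i$, and $(v_i,w_i)$ is a maximizer. Put $\theta_2(P,P')=\theta_2(\mathcal U_P,\mathcal U_{P'})$. **Assumptions.** 1. (Steepness) $h$ is differentiable in $\operatorname{int}\mathcal X$, and $\|\nabla h(p_l)\|_2\to\infty$ whenever $(p_l)$ is a sequence in $\operatorname{int}\mathcal X$ converging to a point of the relative boundary of $\Delta_{\mathcal A}$. 2. (Exploration)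 For every transition law $P$ there is $\nu_{\min}>0$ such that $\sum_a\mu(s,a)\ge\nu_{\min}$ for all $\mu\in\mathcal M_P$ and $s\in\mathcal S$. 3. (Regularity) There is $\eta>0$ such that for every transition law $P$: (a) $\bar h(\mu')\ge\bar h(\mu)+\langle\nabla\bar h(\mu),\mu'-\mu\rangle+\frac\eta2\|\mu'-\mu\|_2^2$ for all $\mu\in\operatorname{relint}\mathcal M_P$ and $\mu'\in\mathcal M_P$; (b) for each closed convex $\mathcal K\subseteq\operatorname{relint}\mathcal M_P$ there is $L_{\mathcal K}>0$ such that $\|\nabla\bar h(\mu)-\nabla\bar h(\mu')\|_2\le L_{\mathcal K}\|\mu-\mu'\|_2$ for all $\mu,\mu'\in\mathcal K$. **Theorem.** Let $\mathcal R\subseteq\mathbb R^{\mathcal S\times\mathcal A}$ be compact and let $P^0,P^1$ be transition laws with $\theta_2(P^0,P^1)>0$. Under the assumptions above, there is a constant $\sigma_{\mathcal R}>0$ such that $$\frac{\sigma_{\mathcal R}}2\,\bigl\|[r]-[r']\bigr\|^2_{\mathbb R^{\mathcal S\times\mathcal A}/\mathcal U_{P^k}}\le\mathsf{SubOpt}_{P^k}\bigl(r',\mathsf{RL}_{P^k}(r)\bigr)\qquad\text{for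 all }r,r'\in\mathcal R,\ k=0,1, \tag{$*$}$$ where the norm is the quotient norm of the Euclidean norm. Moreover, for every $\sigma_{\mathcal R}>0$ satisfying $(*)$, all $r^{\mathsf E},\hat r\in\mathcal R$ and all $\hat\varepsilon$: if the experts $\mu^{\mathsf E}_{P^k}=\mathsf{RL}_{P^k}(r^{\mathsf E})$ satisfy $\mathsf{SubOpt}_{P^k}(\hat r,\mu^{\mathsf E}_{P^k})\le\hat\varepsilon$ for $k=0,1$, then $\hat r$ is $\varepsilon$-transferable to the set of all transition laws, that is, for every transition law $P$ the optimal occupancy measure $\mathsf{RL}_P(\hat r)$ exists, is unique, and satisfies $$\mathsf{SubOpt}_P\bigl(r^{\mathsf E},\mathsf{RL}_P(\hat r)\bigr)\le\varepsilon=\frac{\hat\varepsilon}{\eta\,\sigma_{\mathcal R}\,\sin\bigl(\theta_2(P^0,P^1)/2\bigr)^2}.$$ -/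

import Mathlib

open Filter Topology
open scoped InnerProductSpace

/-! ### Principal angles between subspaces -/

section PrincipalAngles

variable {E : Type*} [NormedAddCommGroup E] [InnerProductSpace ℝ E]

/-- The `i`-th pair `(vᵢ, wᵢ)` of principal vectors (`i ≥ 1`) of two subspaces `V`, `W`: a maximizer
of `⟪v, w⟫` over all unit vectors `v ∈ V`, `w ∈ W` with `⟪v, vⱼ⟫ = ⟪w, wⱼ⟫ = 0` for `1 ≤ j < i`. -/
noncomputable def principalPair (V W : Submodule ℝ E) (i : ℕ) : E × E :=
  Classical.epsilon fun p : E × E =>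
    let feasible : Set (E × E) := {q | q.1 ∈ V ∧ q.2 ∈ W ∧ ‖q.1‖ = 1 ∧ ‖q.2‖ = 1 ∧
      ∀ j, 1 ≤ j → ∀ _ : j < i,
        ⟪q.1, (principalPair V W j).1⟫_ℝ = 0 ∧ ⟪q.2, (principalPair V W j).2⟫_ℝ = 0}
    p ∈ feasible ∧ IsMaxOn (fun q : E × E => ⟪q.1, q.2⟫_ℝ) feasible p
termination_by i

/-- The `i`-th principal angle `θᵢ(V, W) ∈ [0, π/2]`, for `1 ≤ i ≤ dim V = dim W`. -/
noncomputable def principalAngle (V W : Submodule ℝ E) (i : ℕ) : ℝ :=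
  Real.arccos ⟪(principalPair V W i).1, (principalPair V W i).2⟫_ℝ

end PrincipalAngles

/-! ### Regularized Markov decision processes -/

section RegularizedMDP

/-- Transition laws: `(P (s, a)) s'` is the probability `P(s' | s, a)`. -/
abbrev TransitionLaw (S A : Type*) [Fintype S] : Type _ := S × A → stdSimplex ℝ S

/-- The probability simplex over `A`, in the Euclidean space `ℝ^A`. -/
def simplex (A : Type*) [Fintype A] : Set (EuclideanSpace ℝ A) :=
  {p | (∀ a, 0 ≤ p a) ∧ ∑ a, p a = 1}

variable {S A : Type*} [Fintype S] [Fintype A]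

/-- The operator `E - γ P : ℝ^S → ℝ^(S × A)`, where `(E v)(s, a) = v s` and
`(P v)(s, a) = ∑ s', P(s' | s, a) v(s')`. -/
noncomputable def shapingMap (γ : ℝ) (P : TransitionLaw S A) :
    EuclideanSpace ℝ S →ₗ[ℝ] EuclideanSpace ℝ (S × A) where
  toFun v := WithLp.toLp 2 fun x => v x.1 - γ * ∑ s', (P x : S → ℝ) s' * v s'
  map_add' v w := by
    ext x
    simp only [PiLp.add_apply, mul_add, Finset.sum_add_distrib]
    ring
  map_smul' c v := by
    ext x
    simp only [PiLp.smul_apply, smul_eq_mul, RingHom.id_apply, mul_sub, Finset.mul_sum]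
    congr 1
    refine Finset.sum_congr rfl fun s' _ => ?_
    ring

/-- The subspace `𝒰_P = im (E - γ P)` of potential shaping transformations. -/
noncomputable def potentialShaping (γ : ℝ) (P : TransitionLaw S A) :
    Submodule ℝ (EuclideanSpace ℝ (S × A)) :=
  LinearMap.range (shapingMap γ P)

/-- The set `ℳ_P` of occupancy measures, given by the Bellman flow constraints
`μ ≥ 0` and `(E - γ P)ᵀ μ = (1 - γ) ν₀`. -/
def occMeasures (γ : ℝ) (ν₀ : stdSimplex ℝ S) (P : TransitionLaw S A) :
    Set (EuclideanSpace ℝ (S × A)) :=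
  {μ | (∀ x, 0 ≤ μ x) ∧
    LinearMap.adjoint (shapingMap γ P) μ = (1 - γ) • WithLp.toLp 2 (ν₀ : S → ℝ)}

/-- The state marginal `ν(s) = ∑ a, μ(s, a)`. -/
def stateMarginal (μ : EuclideanSpace ℝ (S × A)) (s : S) : ℝ := ∑ a, μ (s, a)

/-- The conditional distribution `π^μ(· | s)`. -/
noncomputable def policyOf (μ : EuclideanSpace ℝ (S × A)) (s : S) : EuclideanSpace ℝ A :=
  WithLp.toLp 2 fun a =>
    if 0 < stateMarginal μ s then μ (s, a) / stateMarginal μ s else 1 / (Fintype.card A : ℝ)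

/-- The occupancy measure regularizer `h̄(μ) = ∑ (s, a), μ(s, a) h(π^μ(· | s))`. -/
noncomputable def occReg (h : EuclideanSpace ℝ A → ℝ) (μ : EuclideanSpace ℝ (S × A)) : ℝ :=
  ∑ x : S × A, μ x * h (policyOf μ x.1)

/-- The regularized objective `J(r, μ) = ⟪r, μ⟫ - h̄(μ)`. -/
noncomputable def objective (h : EuclideanSpace ℝ A → ℝ) (r μ : EuclideanSpace ℝ (S × A)) : ℝ :=
  ⟪r, μ⟫_ℝ - occReg h μ

/-- The set `argmax_{μ ∈ ℳ_P} J(r, μ)` of optimal occupancy measures for the reward `r`. -/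
def optOcc (γ : ℝ) (ν₀ : stdSimplex ℝ S) (h : EuclideanSpace ℝ A → ℝ) (P : TransitionLaw S A)
    (r : EuclideanSpace ℝ (S × A)) : Set (EuclideanSpace ℝ (S × A)) :=
  {μ | μ ∈ occMeasures γ ν₀ P ∧ IsMaxOn (objective h r) (occMeasures γ ν₀ P) μ}

/-- The suboptimality `SubOpt_P(r, μ) = max_{μ' ∈ ℳ_P} J(r, μ') - J(r, μ)`. -/
noncomputable def subOpt (γ : ℝ) (ν₀ : stdSimplex ℝ S) (h : EuclideanSpace ℝ A → ℝ)
    (P : TransitionLaw S A) (r μ : EuclideanSpace ℝ (S × A)) : ℝ :=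
  sSup (objective h r '' occMeasures γ ν₀ P) - objective h r μ

/-- `r'` is `ε`-transferable to the set `Ps` of transition laws, `r` being the experts' reward:
for all `P ∈ Ps`, the optimal occupancy measure for `r'` (exists, is unique, and) is
`ε`-optimal for `r` under `P`. -/
def IsTransferable (γ : ℝ) (ν₀ : stdSimplex ℝ S) (h : EuclideanSpace ℝ A → ℝ)
    (r r' : EuclideanSpace ℝ (S × A)) (ε : ℝ) (Ps : Set (TransitionLaw S A)) : Prop :=
  ∀ P ∈ Ps, ∃ μ, optOcc γ ν₀ h P r' = {μ} ∧ subOpt γ ν₀ h P r μ ≤ ε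

/-! ### Assumptions -/

/-- A regularizer `h : 𝒳 → ℝ`: strictly convex on the closed convex set `𝒳 ⊆ ℝ^A`, whose interior
contains the relative interior of the simplex. Values of `h` outside `𝒳` play no role. -/
structure IsRegularizer (X : Set (EuclideanSpace ℝ A)) (h : EuclideanSpace ℝ A → ℝ) : Prop where
  isClosed : IsClosed X
  strictConvexOn : StrictConvexOn ℝ X h
  relint_subset : intrinsicInterior ℝ (simplex A) ⊆ interior X

/-- Steepness: `h` is differentiable in the interior of `𝒳` and `‖∇h(pₗ)‖ → ∞` for all sequences in
the interior of `𝒳` that converge to a point of the relative boundary of the simplex. -/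
structure IsSteep (X : Set (EuclideanSpace ℝ A)) (h : EuclideanSpace ℝ A → ℝ) : Prop where
  differentiableAt : ∀ p ∈ interior X, DifferentiableAt ℝ h p
  tendsto_norm_gradient : ∀ p ∈ intrinsicFrontier ℝ (simplex A), ∀ u : ℕ → EuclideanSpace ℝ A,
    (∀ l, u l ∈ interior X) → Tendsto u atTop (𝓝 p) →
      Tendsto (fun l => ‖gradient h (u l)‖) atTop atTop

/-- Exploration under `P`: the state marginals of all occupancy measures are bounded away from
zero. -/
def Exploration (γ : ℝ) (ν₀ : stdSimplex ℝ S) (P : TransitionLaw S A) : Prop :=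
  ∃ νmin : ℝ, 0 < νmin ∧ ∀ μ ∈ occMeasures γ ν₀ P, ∀ s, νmin ≤ stateMarginal μ s

/-- `h̄` is `η`-strongly convex over `ℳ_P` (the gradient of `h̄` is taken at points of the relative
interior of `ℳ_P`, which is where it exists). -/
def OccStronglyConvex (γ : ℝ) (ν₀ : stdSimplex ℝ S) (h : EuclideanSpace ℝ A → ℝ) (η : ℝ)
    (P : TransitionLaw S A) : Prop :=
  ∀ μ ∈ intrinsicInterior ℝ (occMeasures γ ν₀ P), ∀ μ' ∈ occMeasures γ ν₀ P,
    occReg h μ + ⟪gradient (occReg h) μ, μ' - μ⟫_ℝ + η / 2 * ‖μ' - μ‖ ^ 2 ≤ occReg h μ'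

/-- `∇h̄` is locally Lipschitz over the relative interior of `ℳ_P`: it is Lipschitz on each closed
convex subset. -/
def OccLocallyLipschitzGradient (γ : ℝ) (ν₀ : stdSimplex ℝ S) (h : EuclideanSpace ℝ A → ℝ)
    (P : TransitionLaw S A) : Prop :=
  ∀ K ⊆ intrinsicInterior ℝ (occMeasures γ ν₀ P), IsClosed K → Convex ℝ K →
    ∃ L : ℝ, 0 < L ∧ ∀ μ ∈ K, ∀ μ' ∈ K,
      ‖gradient (occReg h) μ - gradient (occReg h) μ'‖ ≤ L * ‖μ - μ'‖

/-- `σ` is a dual strong convexity constant of the reward class `R` under `P`: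
`(σ / 2) ‖[r] - [r']‖² ≤ SubOpt_P(r', RL_P(r))` for all `r, r' ∈ R`, where `[·]` is the class modulo
`𝒰_P` and the norm is the quotient norm. -/
def IsDualConvexityConst (γ : ℝ) (ν₀ : stdSimplex ℝ S) (h : EuclideanSpace ℝ A → ℝ)
    (R : Set (EuclideanSpace ℝ (S × A))) (P : TransitionLaw S A) (σ : ℝ) : Prop :=
  ∀ r ∈ R, ∀ r' ∈ R, ∀ μ ∈ optOcc γ ν₀ h P r,
    σ / 2 * ‖(potentialShaping γ P).mkQ r - (potentialShaping γ P).mkQ r'‖ ^ 2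
      ≤ subOpt γ ν₀ h P r' μ

end RegularizedMDP

/-! Optimality for a reward `r` is stationarity: there is a positive `μ` in `ℳ_P` with `r - ∇h̄(μ) ∈
𝒰_P` (`exists_stationary_occMeasure`). Since `𝒰_P` annihilates differences of occupancy measures,
strong convexity turns this into a quadratic growth bound at `μ`
(`OccStronglyConvex.objective_add_le_of_stationary`), valid up to the boundary, whence existence and
uniqueness of the optimum.

The hard point is positivity. Nothing makes `h̄` continuous on the boundary of `ℳ_P`, so a
maximizing sequence is taken among positive measures. If its limit had a zero coordinate, steepness
would make the objective grow arbitrarily fast from near that limit into the interior, contradicting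
concavity and maximality (`pos_of_tendsto_of_maximizing`).

For `(*)`, the optimum depends continuously on `r`, so the optima of the compact class `R` stay in a
closed convex part of the relative interior. There `∇h̄` is Lipschitz, so the distance of rewards
modulo `𝒰_P` is at most a multiple of the distance of optima, whose square bounds the suboptimality
from below (`exists_isDualConvexityConst`).

For transfer, `(*)` says that `rE - rhat` is close to both `𝒰_{P⁰}` and `𝒰_{P¹}`. These share the
line of constant rewards, and as `θ₂ > 0` nothing else, so `rE - rhat` is quantitatively close to
this line (`norm_sub_starProjection_mul_sin_le`). Constants lie in `𝒰_Q` for every `Q`, so the two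
rewards are close modulo `𝒰_Q`, and near equivalence bounds the suboptimality
(`OccStronglyConvex.subOpt_le`). -/

section NonnegativeAffine

/-! ### Relative interiors of affine slices of the nonnegative orthant. -/

variable {ι F : Type*} [Fintype ι] [AddCommGroup F] [Module ℝ F]

theorem pos_of_mem_intrinsicInterior {L : EuclideanSpace ℝ ι →ₗ[ℝ] F} {b : F}
    {p₀ p : EuclideanSpace ℝ ι} (hp₀ : ∀ i, 0 < p₀ i) (hp₀b : L p₀ = b)
    (hp : p ∈ intrinsicInterior ℝ {x : EuclideanSpace ℝ ι | (∀ i, 0 ≤ x i) ∧ L x = b}) (i : ι) :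
    0 < p i := by
  set s := {x : EuclideanSpace ℝ ι | (∀ i, 0 ≤ x i) ∧ L x = b} with hs
  have hps : p ∈ s := intrinsicInterior_subset hp
  obtain ⟨y, hy, rfl⟩ := mem_intrinsicInterior.1 hp
  have hp₀s : p₀ ∈ s := ⟨fun i => (hp₀ i).le, hp₀b⟩
  have hline (t : ℝ) : AffineMap.lineMap (y : EuclideanSpace ℝ ι) p₀ t ∈ affineSpan ℝ s :=
    AffineMap.lineMap_mem t y.2 (subset_affineSpan ℝ s hp₀s)
  let g : ℝ → affineSpan ℝ s := fun t => ⟨AffineMap.lineMap (y : EuclideanSpace ℝ ι) p₀ t, hline t⟩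
  have hg : Continuous g := by
    refine Continuous.subtype_mk ?_ _
    exact AffineMap.lineMap_continuous
  have hg0 : g 0 = y := Subtype.ext (by simp [g])
  have hev : ∀ᶠ t in 𝓝 (0 : ℝ), g t ∈ ((↑) ⁻¹' s : Set (affineSpan ℝ s)) := by
    have : ((↑) ⁻¹' s : Set (affineSpan ℝ s)) ∈ 𝓝 (g 0) := by
      rw [hg0]; exact mem_interior_iff_mem_nhds.1 hy
    exact hg.continuousAt this
  -- A slightly negative parameter moves past `p`, away from `p₀`, and stays in the set; a zero
  -- coordinate of `p` would become negative there.
  obtain ⟨t, ht, ht0⟩ := ((hev.filter_mono nhdsWithin_le_nhds).and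
    (self_mem_nhdsWithin : Set.Iio (0 : ℝ) ∈ 𝓝[<] 0)).exists
  have h1 := ht.1 i
  simp only [g, AffineMap.lineMap_apply_module, PiLp.add_apply, PiLp.smul_apply, smul_eq_mul] at h1
  have h2 : t < 0 := ht0
  rcases (hps.1 i).lt_or_eq with h | h
  · exact h
  · rw [← h] at h1
    nlinarith [hp₀ i]

theorem mem_intrinsicInterior_of_pos {L : EuclideanSpace ℝ ι →ₗ[ℝ] F} {b : F}
    {p : EuclideanSpace ℝ ι} (hp : ∀ i, 0 < p i) (hpb : L p = b) :
    p ∈ intrinsicInterior ℝ {x : EuclideanSpace ℝ ι | (∀ i, 0 ≤ x i) ∧ L x = b} := by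
  set s := {x : EuclideanSpace ℝ ι | (∀ i, 0 ≤ x i) ∧ L x = b} with hs
  have hps : p ∈ s := ⟨fun i => (hp i).le, hpb⟩
  have hspan : ∀ x ∈ affineSpan ℝ s, L x = b := by
    intro x hx
    refine affineSpan_induction hx (fun x hx => hx.2) fun c u v w hu hv hw => ?_
    simp [hu, hv, hw]
  refine mem_intrinsicInterior.2 ⟨⟨p, subset_affineSpan ℝ s hps⟩, ?_, rfl⟩
  rw [mem_interior_iff_mem_nhds]
  have h1 : ∀ᶠ y : affineSpan ℝ s in 𝓝 ⟨p, subset_affineSpan ℝ s hps⟩,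
      ∀ i, 0 < (y : EuclideanSpace ℝ ι) i := by
    refine eventually_all.2 fun i => ?_
    have hc : Continuous fun y : affineSpan ℝ s => (y : EuclideanSpace ℝ ι) i := by fun_prop
    exact hc.continuousAt.eventually (lt_mem_nhds (hp i))
  filter_upwards [h1] with y hy
  exact ⟨fun i => (hy i).le, hspan y y.2⟩

theorem simplex_eq_setOf_linearMap (A : Type*) [Fintype A] :
    simplex A = {x : EuclideanSpace ℝ A | (∀ i, 0 ≤ x i) ∧
      (∑ a, (EuclideanSpace.projₗ a : EuclideanSpace ℝ A →ₗ[ℝ] ℝ)) x = 1} := by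
  ext x
  simp [simplex, LinearMap.sum_apply]

end NonnegativeAffine

section Simplex

variable {A : Type*} [Fintype A]

theorem mem_intrinsicInterior_simplex {p : EuclideanSpace ℝ A} (hp : ∀ a, 0 < p a)
    (hsum : ∑ a, p a = 1) : p ∈ intrinsicInterior ℝ (simplex A) := by
  rw [simplex_eq_setOf_linearMap]
  exact mem_intrinsicInterior_of_pos hp (by simpa [LinearMap.sum_apply] using hsum)

theorem mem_intrinsicFrontier_simplex [Nonempty A] {p : EuclideanSpace ℝ A} (hp : p ∈ simplex A)
    {a : A} (ha : p a = 0) : p ∈ intrinsicFrontier ℝ (simplex A) := by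
  have h1 : p ∈ intrinsicInterior ℝ (simplex A) ∪ intrinsicFrontier ℝ (simplex A) := by
    rw [intrinsicInterior_union_intrinsicFrontier]
    exact subset_intrinsicClosure hp
  rcases h1 with h1 | h1
  · rw [simplex_eq_setOf_linearMap] at h1
    have := pos_of_mem_intrinsicInterior
      (p₀ := WithLp.toLp 2 fun _ : A => (Fintype.card A : ℝ)⁻¹)
      (fun _ => inv_pos.2 (Nat.cast_pos.2 Fintype.card_pos))
      (by simp [LinearMap.sum_apply]) h1 a
    exact absurd ha this.ne'
  · exact h1

end Simplex

/-! ### Tangent inequalities for convex functions. -/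

section ConvexGradient

variable {E : Type*} [NormedAddCommGroup E] [InnerProductSpace ℝ E] [CompleteSpace E]

theorem HasGradientAt.hasDerivAt_comp_add_smul {f : E → ℝ} {g x : E} (hf : HasGradientAt f g x)
    (v : E) : HasDerivAt (fun t : ℝ => f (x + t • v)) ⟪g, v⟫_ℝ 0 := by
  have h1 : HasDerivAt (fun t : ℝ => x + t • v) v 0 := by
    simpa using ((hasDerivAt_id (0 : ℝ)).smul_const v).const_add x
  have h2 : HasFDerivAt f ((InnerProductSpace.toDual ℝ E) g) (x + (0 : ℝ) • v) := by
    simpa using hf.hasFDerivAt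
  exact h2.comp_hasDerivAt (0 : ℝ) h1

theorem ConvexOn.add_inner_gradient_le {s : Set E} {f : E → ℝ} (hf : ConvexOn ℝ s f) {x y : E}
    (hx : x ∈ s) (hy : y ∈ s) (hd : DifferentiableAt ℝ f x) :
    f x + ⟪gradient f x, y - x⟫_ℝ ≤ f y := by
  have h1 := (hd.hasGradientAt.hasDerivAt_comp_add_smul (y - x)).tendsto_slope_zero_right
  have h2 : ⟪gradient f x, y - x⟫_ℝ ≤ f y - f x := by
    refine le_of_tendsto h1 ?_
    filter_upwards [Ioo_mem_nhdsGT (zero_lt_one' ℝ)] with t ht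
    have h3 := hf.2 hx hy (sub_nonneg.2 ht.2.le) ht.1.le (by ring)
    have h4 : (1 - t) • x + t • y = x + t • (y - x) := by module
    rw [h4] at h3
    simp only [smul_eq_mul] at h3 ⊢
    rw [zero_add, zero_smul, add_zero, inv_mul_le_iff₀ ht.1]
    linarith
  linarith

/-- Near the boundary of its domain, a convex function with a large gradient decreases steeply
towards any fixed interior point. -/
theorem ConvexOn.exists_add_inner_gradient_le_sub_norm {s : Set E} {f : E → ℝ}
    (hf : ConvexOn ℝ s f) {q : E} (hq : q ∈ interior s) (hd : DifferentiableAt ℝ f q) :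
    ∃ C ρ : ℝ, 0 < ρ ∧ ∀ x ∈ s, DifferentiableAt ℝ f x →
      f x + ⟪gradient f x, q - x⟫_ℝ ≤ C - ρ * ‖gradient f x‖ := by
  have h0 : ∀ᶠ y in 𝓝 q, y ∈ s := mem_interior_iff_mem_nhds.1 hq
  have h1 : ∀ᶠ y in 𝓝 q, y ∈ s ∧ f y < f q + 1 :=
    h0.and
      (hd.continuousAt.eventually (gt_mem_nhds (lt_add_one _)))
  obtain ⟨ρ, hρ, hball⟩ := Metric.nhds_basis_closedBall.eventually_iff.1 h1
  refine ⟨f q + 1, ρ, hρ, fun x hx hdx => ?_⟩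
  set g := gradient f x with hg
  -- The tangent inequality at `x` is tested at the point of the ball around `q` farthest along the
  -- gradient, which gains `ρ * ‖g‖`; for `g = 0` this point is `q` itself.
  have hy : q + (ρ * ‖g‖⁻¹) • g ∈ Metric.closedBall q ρ := by
    rw [mem_closedBall_iff_norm, add_sub_cancel_left, norm_smul, norm_mul, norm_inv, norm_norm,
      Real.norm_of_nonneg hρ.le, mul_assoc]
    exact mul_le_of_le_one_right hρ.le (inv_mul_le_one)
  obtain ⟨hys, hylt⟩ := hball hy
  have h2 := hf.add_inner_gradient_le hx hys hdx
  rw [← hg, show q + (ρ * ‖g‖⁻¹) • g - x = (q - x) + (ρ * ‖g‖⁻¹) • g by abel, inner_add_right,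
    inner_smul_right, real_inner_self_eq_norm_sq] at h2
  have h3 : ρ * ‖g‖⁻¹ * ‖g‖ ^ 2 = ρ * ‖g‖ := by
    rcases eq_or_ne ‖g‖ 0 with h | h
    · simp [h]
    · field_simp
  linarith

end ConvexGradient

/-! ### Quotient norm and orthogonal projection. -/

section QuotientNorm

variable {E : Type*} [NormedAddCommGroup E] [InnerProductSpace ℝ E]

theorem Submodule.norm_mkQ_sub_le (U : Submodule ℝ E) {r r' x : E} (h : r - r' - x ∈ U) :
    ‖U.mkQ r - U.mkQ r'‖ ≤ ‖x‖ := by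
  have : U.mkQ r - U.mkQ r' = U.mkQ x := by
    rw [← map_sub]
    exact (Submodule.Quotient.eq U).2 h
  rw [this]
  exact Submodule.Quotient.norm_mk_le U x

/-- The quotient norm is the distance to `U`, and the projection onto `Uᗮ` is a contraction that
kills `U`. -/
theorem Submodule.norm_sub_starProjection_le_norm_mkQ (U : Submodule ℝ E)
    [U.HasOrthogonalProjection] (x : E) : ‖x - U.starProjection x‖ ≤ ‖U.mkQ x‖ := by
  have h : ‖U.mkQ x‖ = Metric.infDist x (U : Set E) := QuotientAddGroup.norm_mk (S := U.toAddSubgroup) x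
  rw [h]
  refine (Metric.le_infDist ⟨0, U.zero_mem⟩).2 fun u hu => ?_
  rw [dist_eq_norm, ← Submodule.starProjection_orthogonal_val]
  have : Uᗮ.starProjection u = 0 := by
    rw [Submodule.starProjection_orthogonal_val, Submodule.starProjection_eq_self_iff.2 hu, sub_self]
  rw [← sub_zero (Uᗮ.starProjection x), ← this, ← map_sub]
  exact Uᗮ.norm_starProjection_apply_le _

end QuotientNorm

/-! ### Principal angles and distances to subspaces. -/

section PrincipalAngleBounds

variable {E : Type*} [NormedAddCommGroup E] [InnerProductSpace ℝ E]

/-- The pairs over which the `i`-th principal pair maximizes the inner product. -/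
def principalFeasible (V W : Submodule ℝ E) (i : ℕ) : Set (E × E) :=
  {q | q.1 ∈ V ∧ q.2 ∈ W ∧ ‖q.1‖ = 1 ∧ ‖q.2‖ = 1 ∧ ∀ j, 1 ≤ j → ∀ _ : j < i,
    ⟪q.1, (principalPair V W j).1⟫_ℝ = 0 ∧ ⟪q.2, (principalPair V W j).2⟫_ℝ = 0}

theorem isCompact_principalFeasible [FiniteDimensional ℝ E] (V W : Submodule ℝ E) (i : ℕ) :
    IsCompact (principalFeasible V W i) := by
  refine Metric.isCompact_of_isClosed_isBounded ?_ ?_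
  · have hset : principalFeasible V W i = {q : E × E | q.1 ∈ V} ∩ {q | q.2 ∈ W} ∩ {q | ‖q.1‖ = 1} ∩
        {q | ‖q.2‖ = 1} ∩ ⋂ j, ⋂ (_ : 1 ≤ j), ⋂ (_ : j < i),
          ({q : E × E | ⟪q.1, (principalPair V W j).1⟫_ℝ = 0} ∩
            {q | ⟪q.2, (principalPair V W j).2⟫_ℝ = 0}) := by
      ext q
      simp [principalFeasible, and_assoc]
    rw [hset]
    refine IsClosed.inter (IsClosed.inter (IsClosed.inter (IsClosed.inter ?_ ?_) ?_) ?_) ?_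
    · exact V.closed_of_finiteDimensional.preimage continuous_fst
    · exact W.closed_of_finiteDimensional.preimage continuous_snd
    · exact isClosed_eq (by fun_prop) continuous_const
    · exact isClosed_eq (by fun_prop) continuous_const
    · refine isClosed_iInter fun j => isClosed_iInter fun _ => isClosed_iInter fun _ => ?_
      exact (isClosed_eq (by fun_prop) continuous_const).inter
        (isClosed_eq (by fun_prop) continuous_const)
  · refine (Metric.isBounded_closedBall (x := (0 : E × E)) (r := 1)).subset fun q hq => ?_
    rw [mem_closedBall_zero_iff, Prod.norm_def]
    exact max_le hq.2.2.1.le hq.2.2.2.1.le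

/-- Compactness provides a maximizer, so the choice operator in the definition returns one rather
than a junk value. -/
theorem principalPair_spec [FiniteDimensional ℝ E] {V W : Submodule ℝ E} {i : ℕ}
    (hne : (principalFeasible V W i).Nonempty) :
    principalPair V W i ∈ principalFeasible V W i ∧
      IsMaxOn (fun q : E × E => ⟪q.1, q.2⟫_ℝ) (principalFeasible V W i) (principalPair V W i) := by
  obtain ⟨p, hp, hmax⟩ := (isCompact_principalFeasible V W i).exists_isMaxOn hne
    (f := fun q : E × E => ⟪q.1, q.2⟫_ℝ) (by fun_prop)
  have h := Classical.epsilon_spec (p := fun p : E × E => p ∈ principalFeasible V W i ∧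
    IsMaxOn (fun q : E × E => ⟪q.1, q.2⟫_ℝ) (principalFeasible V W i) p) ⟨p, hp, hmax⟩
  rw [principalPair]
  exact h

/-- If the second principal angle is positive, then the first principal vectors coincide and span
the intersection of the two subspaces. -/
theorem principalPair_one_of_mem_inf [FiniteDimensional ℝ E] {V W : Submodule ℝ E}
    (hθ : 0 < principalAngle V W 2) {e : E} (heV : e ∈ V) (heW : e ∈ W) (he : ‖e‖ = 1) :
    ∃ c : ℝ, principalPair V W 1 = (c • e, c • e) := by
  have hmem : (e, e) ∈ principalFeasible V W 1 := by
    refine ⟨heV, heW, he, he, fun j h1 h2 => ?_⟩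
    omega
  obtain ⟨⟨h1V, h1W, hn1, hn2, -⟩, hmax⟩ := principalPair_spec ⟨_, hmem⟩
  have h1 := hmax hmem
  simp only [Set.mem_ofPred_eq, real_inner_self_eq_norm_sq, he] at h1
  -- The pair `(e, e)` already has inner product 1, so equality holds in Cauchy-Schwarz for the
  -- first principal pair.
  have heq : (principalPair V W 1).1 = (principalPair V W 1).2 := by
    refine (inner_eq_one_iff_of_norm_eq_one (𝕜 := ℝ) hn1 hn2).1 (le_antisymm ?_ (by linarith))
    have := real_inner_le_norm (principalPair V W 1).1 (principalPair V W 1).2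
    rwa [hn1, hn2, one_mul] at this
  set f := (principalPair V W 1).1 with hf
  rw [← heq] at h1W
  by_cases hu : e - ⟪e, f⟫_ℝ • f = 0
  · have hne : ⟪e, f⟫_ℝ ≠ 0 := by
      intro h0
      rw [h0, zero_smul, sub_zero] at hu
      rw [hu, norm_zero] at he
      exact zero_ne_one he
    have hfe : f = (⟪e, f⟫_ℝ)⁻¹ • e := by
      rw [sub_eq_zero] at hu
      nth_rewrite 2 [hu]
      rw [smul_smul, inv_mul_cancel₀ hne, one_smul]
    exact ⟨(⟪e, f⟫_ℝ)⁻¹, Prod.ext hfe (heq.symm.trans hfe)⟩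
  -- The component of `e` orthogonal to `f` lies in both subspaces. If it is nonzero, its
  -- normalization paired with itself is feasible for index 2 with inner product 1, forcing the
  -- second angle to be 0.
  · exfalso
    set u := e - ⟪e, f⟫_ℝ • f with hu_def
    have huf : ⟪u, f⟫_ℝ = 0 := by
      rw [hu_def, inner_sub_left, inner_smul_left, real_inner_self_eq_norm_sq, hn1]
      simp
    have huV : u ∈ V := V.sub_mem heV (V.smul_mem _ h1V)
    have huW : u ∈ W := W.sub_mem heW (W.smul_mem _ h1W)
    have hun : ‖‖u‖⁻¹ • u‖ = 1 := norm_smul_inv_norm hu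
    have hmem2 : (‖u‖⁻¹ • u, ‖u‖⁻¹ • u) ∈ principalFeasible V W 2 := by
      refine ⟨V.smul_mem _ huV, W.smul_mem _ huW, hun, hun, fun j h1 h2 => ?_⟩
      obtain rfl : j = 1 := by omega
      rw [← heq, ← hf]
      simp [inner_smul_left, huf]
    have h2 := (principalPair_spec ⟨_, hmem2⟩).2 hmem2
    simp only [Set.mem_ofPred_eq, real_inner_self_eq_norm_sq, hun] at h2
    rw [principalAngle, Real.arccos_pos] at hθ
    linarith

theorem sin_angle_mul_norm_starProjection (U : Submodule ℝ E) [U.HasOrthogonalProjection] {y : E}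
    (hy : U.starProjection y ≠ 0) :
    Real.sin (InnerProductGeometry.angle y (U.starProjection y)) * ‖y‖ =
      ‖y - U.starProjection y‖ := by
  set p := U.starProjection y with hp
  have hin : ⟪y, p⟫_ℝ = ‖p‖ ^ 2 := by
    have h := Submodule.starProjection_inner_eq_zero (K := U) y p (U.starProjection_apply_mem y)
    rw [inner_sub_left, sub_eq_zero] at h
    rw [h, ← hp, real_inner_self_eq_norm_sq]
  have hm : ‖p‖ ≠ 0 := norm_ne_zero_iff.2 hy
  have h1 := InnerProductGeometry.sin_angle_mul_norm_mul_norm y p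
  have h3 : ‖y - p‖ ^ 2 = ‖y‖ ^ 2 - ‖p‖ ^ 2 := by
    rw [norm_sub_sq_real, hin]; ring
  have h2 : 0 ≤ ⟪y, y⟫_ℝ * ⟪p, p⟫_ℝ - ⟪y, p⟫_ℝ * ⟪y, p⟫_ℝ := by
    rw [real_inner_self_eq_norm_sq, real_inner_self_eq_norm_sq, hin]
    nlinarith [mul_nonneg (sq_nonneg ‖y - p‖) (sq_nonneg ‖p‖)]
  have h4 := congrArg (· ^ 2) h1
  simp only [Real.sq_sqrt h2] at h4
  rw [real_inner_self_eq_norm_sq, real_inner_self_eq_norm_sq, hin] at h4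
  refine (sq_eq_sq₀ (mul_nonneg (InnerProductGeometry.sin_angle_nonneg _ _) (norm_nonneg _))
    (norm_nonneg _)).1 ?_
  rw [h3]
  have h5 : ‖p‖ ^ 2 ≠ 0 := pow_ne_zero _ hm
  refine mul_right_cancel₀ h5 ?_
  nlinarith

theorem angle_starProjection_le (U : Submodule ℝ E) [U.HasOrthogonalProjection] (y : E) :
    InnerProductGeometry.angle y (U.starProjection y) ≤ Real.pi / 2 := by
  rw [InnerProductGeometry.angle, Real.arccos_le_pi_div_two]
  have h := Submodule.starProjection_inner_eq_zero (K := U) y _ (U.starProjection_apply_mem y)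
  rw [inner_sub_left, sub_eq_zero, real_inner_self_eq_norm_sq] at h
  rw [h]
  positivity

theorem principalAngle_two_le_angle [FiniteDimensional ℝ E] {V W : Submodule ℝ E} {e : E} {c : ℝ}
    (hc : principalPair V W 1 = (c • e, c • e)) {v w : E} (hvV : v ∈ V) (hwW : w ∈ W)
    (hve : ⟪v, e⟫_ℝ = 0) (hwe : ⟪w, e⟫_ℝ = 0) (hv : v ≠ 0) (hw : w ≠ 0) :
    principalAngle V W 2 ≤ InnerProductGeometry.angle v w ∧
      principalAngle V W 2 ≤ Real.pi / 2 := by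
  -- Both signs are needed: `s = 1` compares with the angle of `v` and `w`, and `s = -1` shows that
  -- the maximum is nonnegative.
  have hmem (s : ℝ) (hs : ‖s‖ = 1) :
      (‖v‖⁻¹ • v, s • ‖w‖⁻¹ • w) ∈ principalFeasible V W 2 := by
    refine ⟨V.smul_mem _ hvV, W.smul_mem _ (W.smul_mem _ hwW), norm_smul_inv_norm hv, ?_,
      fun j h1 h2 => ?_⟩
    · rw [norm_smul, hs, one_mul]
      exact norm_smul_inv_norm hw
    · obtain rfl : j = 1 := by omega
      simp [hc, inner_smul_left, inner_smul_right, hve, hwe]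
  have hmax := (principalPair_spec ⟨_, hmem 1 (by simp)⟩).2
  have h1 := hmax (hmem 1 (by simp))
  have h2 := hmax (hmem (-1) (by simp))
  simp only [Set.mem_ofPred_eq, inner_smul_left, inner_smul_right, RCLike.conj_to_real] at h1 h2
  constructor
  · rw [principalAngle, InnerProductGeometry.angle]
    refine Real.arccos_le_arccos (le_trans (le_of_eq ?_) h1)
    rw [div_eq_mul_inv, mul_inv]
    ring
  · rw [principalAngle, Real.arccos_le_pi_div_two]
    linarith

/-- The distances of a vector to two subspaces control its distance to their intersection, through
the second principal angle, when this intersection is a line. -/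
theorem norm_sub_starProjection_mul_sin_le [FiniteDimensional ℝ E] {V W : Submodule ℝ E}
    (hθ : 0 < principalAngle V W 2) {e : E} (heV : e ∈ V) (heW : e ∈ W) (he : ‖e‖ = 1) (x : E) :
    ‖x - (ℝ ∙ e).starProjection x‖ * Real.sin (principalAngle V W 2 / 2) ≤
      max ‖x - V.starProjection x‖ ‖x - W.starProjection x‖ := by
  obtain ⟨c, hc⟩ := principalPair_one_of_mem_inf hθ heV heW he
  set z := (ℝ ∙ e).starProjection x with hz
  have hzmem : z ∈ ℝ ∙ e := Submodule.starProjection_apply_mem _ _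
  set y := x - z with hy
  have hye : ⟪y, e⟫_ℝ = 0 :=
    Submodule.starProjection_inner_eq_zero (K := ℝ ∙ e) x e (Submodule.mem_span_singleton_self e)
  have hproj (U : Submodule ℝ E) (heU : e ∈ U) :
      x - U.starProjection x = y - U.starProjection y := by
    have hzU : z ∈ U := (Submodule.span_singleton_le_iff_mem e U).2 heU hzmem
    rw [hy, map_sub, Submodule.starProjection_eq_self_iff.2 hzU]
    abel
  -- As `e` lies in `U`, projecting onto `U` preserves orthogonality to `e`; the two projections of
  -- `y` thus compete for the second principal pair.
  have horth (U : Submodule ℝ E) (heU : e ∈ U) : ⟪U.starProjection y, e⟫_ℝ = 0 := by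
    rw [Submodule.inner_starProjection_left_eq_right, Submodule.starProjection_eq_self_iff.2 heU, hye]
  rw [hproj V heV, hproj W heW]
  have htriv : ‖y‖ * Real.sin (principalAngle V W 2 / 2) ≤ ‖y‖ :=
    mul_le_of_le_one_right (norm_nonneg _) (Real.sin_le_one _)
  by_cases hv : V.starProjection y = 0
  · refine le_max_of_le_left ?_
    rwa [hv, sub_zero]
  by_cases hw : W.starProjection y = 0
  · refine le_max_of_le_right ?_
    rwa [hw, sub_zero]
  obtain ⟨h1, h2⟩ := principalAngle_two_le_angle hc (V.starProjection_apply_mem y)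
    (W.starProjection_apply_mem y) (horth V heV) (horth W heW) hv hw
  -- The two projections make an angle of at least `θ₂`, so by the triangle inequality for angles
  -- `y` makes an angle of at least `θ₂ / 2` with one of them. This is the origin of the half angle.
  have h3 := InnerProductGeometry.angle_le_angle_add_angle (V.starProjection y) y
    (W.starProjection y)
  rw [InnerProductGeometry.angle_comm _ y] at h3
  have key (U : Submodule ℝ E) (hU : U.starProjection y ≠ 0)
      (hle : principalAngle V W 2 / 2 ≤ InnerProductGeometry.angle y (U.starProjection y)) :
      ‖y‖ * Real.sin (principalAngle V W 2 / 2) ≤ ‖y - U.starProjection y‖ := by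
    rw [← sin_angle_mul_norm_starProjection U hU, mul_comm]
    refine mul_le_mul_of_nonneg_right ?_ (norm_nonneg _)
    exact Real.sin_le_sin_of_le_of_le_pi_div_two (by linarith [Real.pi_pos])
      (angle_starProjection_le U y) hle
  by_cases hle : principalAngle V W 2 / 2 ≤ InnerProductGeometry.angle y (V.starProjection y)
  · exact le_max_of_le_left (key V hv hle)
  · exact le_max_of_le_right (key W hw (by linarith))

end PrincipalAngleBounds

/-! ### Geometry of occupancy measures and potential shaping. -/

section OccupancyMeasures

variable {S A : Type*} [Fintype S] [Fintype A] {γ : ℝ} {ν₀ : stdSimplex ℝ S}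
  {P : TransitionLaw S A}

theorem adjoint_shapingMap_apply (γ : ℝ) (P : TransitionLaw S A) (μ : EuclideanSpace ℝ (S × A))
    (s : S) : LinearMap.adjoint (shapingMap γ P) μ s =
      stateMarginal μ s - γ * ∑ x, (P x : S → ℝ) s * μ x := by
  classical
  have h1 : LinearMap.adjoint (shapingMap γ P) μ s =
      ⟪EuclideanSpace.single s (1 : ℝ), LinearMap.adjoint (shapingMap γ P) μ⟫_ℝ := by
    simp [EuclideanSpace.inner_single_left]
  rw [h1, LinearMap.adjoint_inner_right, PiLp.inner_apply]
  simp only [shapingMap, LinearMap.coe_mk, AddHom.coe_mk, PiLp.single_apply, mul_ite, mul_one,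
    mul_zero, Finset.sum_ite_eq', Finset.mem_univ, if_true, RCLike.inner_apply, RCLike.conj_to_real,
    mul_sub, Finset.sum_sub_distrib, stateMarginal, Fintype.sum_prod_type, Finset.mul_sum]
  congr 1
  · rw [Finset.sum_eq_single s]
    · simp
    · intro b _ hb; simp [hb]
    · simp
  · refine Finset.sum_congr rfl fun t _ => Finset.sum_congr rfl fun a _ => ?_
    ring

theorem mem_occMeasures_iff {μ : EuclideanSpace ℝ (S × A)} :
    μ ∈ occMeasures γ ν₀ P ↔ (∀ x, 0 ≤ μ x) ∧
      ∀ s, stateMarginal μ s - γ * ∑ x, (P x : S → ℝ) s * μ x = (1 - γ) * (ν₀ : S → ℝ) s := by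
  refine and_congr_right fun _ => ⟨fun h s => ?_, fun h => ?_⟩
  · rw [← adjoint_shapingMap_apply, h]; simp
  · ext s
    rw [adjoint_shapingMap_apply, h]; simp

theorem sum_stateMarginal (μ : EuclideanSpace ℝ (S × A)) : ∑ s, stateMarginal μ s = ∑ x, μ x := by
  rw [Fintype.sum_prod_type]; rfl

theorem sum_eq_one_of_mem_occMeasures (hγ1 : γ < 1) {μ : EuclideanSpace ℝ (S × A)}
    (hμ : μ ∈ occMeasures γ ν₀ P) : ∑ x, μ x = 1 := by
  have h := Finset.sum_congr rfl fun s (_ : s ∈ Finset.univ) => (mem_occMeasures_iff.1 hμ).2 s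
  rw [Finset.sum_sub_distrib, sum_stateMarginal, ← Finset.mul_sum, ← Finset.mul_sum,
    Finset.sum_comm, stdSimplex.sum_eq_one] at h
  simp only [← Finset.sum_mul, stdSimplex.sum_eq_one, one_mul, mul_one] at h
  have h1 : 1 - γ ≠ 0 := by linarith
  refine mul_left_cancel₀ h1 ?_
  linarith

theorem convex_occMeasures : Convex ℝ (occMeasures γ ν₀ P) := by
  intro μ hμ ρ hρ a b ha hb hab
  refine ⟨fun x => ?_, ?_⟩
  · simp only [PiLp.add_apply, PiLp.smul_apply, smul_eq_mul]
    exact add_nonneg (mul_nonneg ha (hμ.1 x)) (mul_nonneg hb (hρ.1 x))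
  · rw [map_add, map_smul, map_smul, hμ.2, hρ.2, ← add_smul, hab, one_smul]

theorem isClosed_occMeasures : IsClosed (occMeasures γ ν₀ P) := by
  have h : occMeasures γ ν₀ P = (⋂ x, {μ | 0 ≤ μ x}) ∩
      {μ | LinearMap.adjoint (shapingMap γ P) μ = (1 - γ) • WithLp.toLp 2 (ν₀ : S → ℝ)} := by
    ext μ; simp [occMeasures]
  rw [h]
  refine (isClosed_iInter fun x => isClosed_le continuous_const (by fun_prop)).inter ?_
  exact isClosed_eq (LinearMap.continuous_of_finiteDimensional _) continuous_const

theorem isCompact_occMeasures (hγ1 : γ < 1) : IsCompact (occMeasures γ ν₀ P) := by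
  refine Metric.isCompact_of_isClosed_isBounded isClosed_occMeasures ?_
  refine (Metric.isBounded_closedBall (x := (0 : EuclideanSpace ℝ (S × A))) (r := 1)).subset
    fun μ hμ => ?_
  rw [mem_closedBall_zero_iff, EuclideanSpace.norm_eq, Real.sqrt_le_one]
  rw [← sum_eq_one_of_mem_occMeasures hγ1 hμ]
  refine Finset.sum_le_sum fun x _ => ?_
  have h0 := hμ.1 x
  have h1 : μ x ≤ 1 := by
    rw [← sum_eq_one_of_mem_occMeasures hγ1 hμ]
    exact Finset.single_le_sum (fun y _ => hμ.1 y) (Finset.mem_univ x)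
  rw [Real.norm_of_nonneg h0]
  nlinarith

/-- A discounted subinvariant nonnegative vector vanishes. -/
theorem eq_zero_of_le_discount_mul (hγ1 : γ < 1) {Q : S → S → ℝ} (hQ : ∀ s, ∑ s', Q s s' = 1)
    {w : S → ℝ} (hw : ∀ s, 0 ≤ w s) (hle : ∀ s', w s' ≤ γ * ∑ s, Q s s' * w s) (s : S) :
    w s = 0 := by
  -- Summed over states, the stochastic matrix preserves mass, so the total mass is at most `γ`
  -- times itself.
  have h := Finset.sum_le_sum fun s (_ : s ∈ Finset.univ) => hle s
  rw [← Finset.mul_sum, Finset.sum_comm] at h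
  simp only [← Finset.sum_mul, hQ, one_mul] at h
  have h0 : 0 ≤ ∑ s, w s := Finset.sum_nonneg fun s _ => hw s
  have h1 : ∑ s, w s = 0 := by nlinarith
  exact (Finset.sum_eq_zero_iff_of_nonneg fun s _ => hw s).1 h1 s (Finset.mem_univ s)

/-- The discounted state distribution of a Markov chain. -/
theorem exists_discounted_stateDistribution (hγ0 : 0 < γ) (hγ1 : γ < 1) {Q : S → S → ℝ}
    (hQ0 : ∀ s s', 0 ≤ Q s s') (hQ : ∀ s, ∑ s', Q s s' = 1) {b : S → ℝ} (hb : ∀ s, 0 ≤ b s) :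
    ∃ w : S → ℝ, (∀ s, 0 ≤ w s) ∧ ∀ s', w s' - γ * ∑ s, Q s s' * w s = b s' := by
  let T : (S → ℝ) →ₗ[ℝ] (S → ℝ) :=
    { toFun := fun w s' => w s' - γ * ∑ s, Q s s' * w s
      map_add' := fun v w => by
        ext s
        simp only [Pi.add_apply, mul_add, Finset.sum_add_distrib]
        ring
      map_smul' := fun c v => by
        ext s
        simp only [Pi.smul_apply, smul_eq_mul, RingHom.id_apply, mul_sub, Finset.mul_sum]
        congr 1
        refine Finset.sum_congr rfl fun s' _ => ?_
        ring }
  -- A kernel vector has a subinvariant absolute value, hence vanishes; in finite dimension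
  -- injectivity gives surjectivity.
  have hTinj : Function.Injective T := by
    refine (injective_iff_map_eq_zero T).2 fun w hw => ?_
    have h1 : ∀ s', w s' = γ * ∑ s, Q s s' * w s := fun s' => sub_eq_zero.1 (congrFun hw s')
    ext s
    refine abs_eq_zero.1 (eq_zero_of_le_discount_mul hγ1 hQ (w := fun s => |w s|)
      (fun s => abs_nonneg _) (fun s' => ?_) s)
    rw [h1 s', abs_mul, abs_of_pos hγ0]
    refine mul_le_mul_of_nonneg_left ((Finset.abs_sum_le_sum_abs _ _).trans
      (Finset.sum_le_sum fun s _ => ?_)) hγ0.le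
    rw [abs_mul, abs_of_nonneg (hQ0 _ _)]
  obtain ⟨w, hw⟩ := (LinearMap.injective_iff_surjective.1 hTinj) b
  have hw' : ∀ s', w s' - γ * ∑ s, Q s s' * w s = b s' := fun s' => congrFun hw s'
  refine ⟨w, fun s => ?_, hw'⟩
  -- The negative part of the solution is subinvariant because `b` is nonnegative.
  refine neg_nonpos.1 (max_eq_right_iff.1 ?_)
  refine eq_zero_of_le_discount_mul hγ1 hQ (w := fun s => max (-w s) 0)
    (fun s => le_max_right _ _) (fun s' => ?_) s
  have hnn : 0 ≤ γ * ∑ s, Q s s' * max (-w s) 0 :=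
    mul_nonneg hγ0.le (Finset.sum_nonneg fun s _ => mul_nonneg (hQ0 _ _) (le_max_right _ _))
  refine max_le ?_ hnn
  have h2 : -∑ s, Q s s' * w s ≤ ∑ s, Q s s' * max (-w s) 0 := by
    rw [← Finset.sum_neg_distrib]
    refine Finset.sum_le_sum fun s _ => ?_
    rw [← mul_neg]
    exact mul_le_mul_of_nonneg_left (le_max_left _ _) (hQ0 _ _)
  have h3 := hw' s'
  have h4 := hb s'
  nlinarith [mul_le_mul_of_nonneg_left h2 hγ0.le]

/-- The witness is the occupancy measure of the uniform policy; exploration makes its state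
marginals positive. -/
theorem exists_pos_mem_occMeasures [Nonempty A] (hγ0 : 0 < γ) (hγ1 : γ < 1)
    (hexp : Exploration γ ν₀ P) : ∃ μ ∈ occMeasures γ ν₀ P, ∀ x, 0 < μ x := by
  have hA : (0 : ℝ) < Fintype.card A := Nat.cast_pos.2 Fintype.card_pos
  obtain ⟨w, hw0, hw⟩ := exists_discounted_stateDistribution hγ0 hγ1
    (Q := fun s s' => ∑ a, (Fintype.card A : ℝ)⁻¹ * (P (s, a) : S → ℝ) s')
    (b := fun s => (1 - γ) * (ν₀ : S → ℝ) s)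
    (fun s s' => Finset.sum_nonneg fun a _ => mul_nonneg (inv_nonneg.2 hA.le) ((P (s, a)).2.1 s'))
    (fun s => by
      rw [Finset.sum_comm]
      simp only [← Finset.mul_sum, stdSimplex.sum_eq_one, Finset.sum_const, Finset.card_univ, nsmul_eq_mul]
      field_simp)
    (fun s => mul_nonneg (by linarith) (ν₀.2.1 s))
  let μ : EuclideanSpace ℝ (S × A) := WithLp.toLp 2 fun x => (Fintype.card A : ℝ)⁻¹ * w x.1
  have hmarg (s : S) : stateMarginal μ s = w s := by
    simp only [stateMarginal, μ, Finset.sum_const, Finset.card_univ, nsmul_eq_mul]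
    field_simp
  have hμ : μ ∈ occMeasures γ ν₀ P := by
    refine mem_occMeasures_iff.2 ⟨fun x => mul_nonneg (inv_nonneg.2 hA.le) (hw0 _), fun s' => ?_⟩
    rw [hmarg, ← hw s', Fintype.sum_prod_type]
    congr 2
    refine Finset.sum_congr rfl fun s _ => ?_
    rw [Finset.sum_mul]
    refine Finset.sum_congr rfl fun a _ => ?_
    simp only [μ]
    ring
  obtain ⟨νmin, hν, hmin⟩ := hexp
  refine ⟨μ, hμ, fun x => mul_pos (inv_pos.2 hA) ?_⟩
  rw [← hmarg]
  exact hν.trans_le (hmin μ hμ x.1)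

theorem mem_intrinsicInterior_occMeasures {μ : EuclideanSpace ℝ (S × A)}
    (hμ : μ ∈ occMeasures γ ν₀ P) (hpos : ∀ x, 0 < μ x) :
    μ ∈ intrinsicInterior ℝ (occMeasures γ ν₀ P) :=
  mem_intrinsicInterior_of_pos hpos hμ.2

/-- The range of an operator is the orthogonal complement of the kernel of its adjoint. That kernel
contains all differences of occupancy measures, so shaping is invisible on `ℳ_P` up to an additive
constant. -/
theorem mem_potentialShaping_iff {v : EuclideanSpace ℝ (S × A)} :
    v ∈ potentialShaping γ P ↔
      ∀ d, LinearMap.adjoint (shapingMap γ P) d = 0 → ⟪d, v⟫_ℝ = 0 := by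
  have h := LinearMap.orthogonal_ker (LinearMap.adjoint (shapingMap γ P))
  rw [LinearMap.adjoint_adjoint] at h
  rw [potentialShaping, ← h, Submodule.mem_orthogonal]
  simp only [LinearMap.mem_ker]

theorem adjoint_sub_eq_zero {μ ρ : EuclideanSpace ℝ (S × A)} (hμ : μ ∈ occMeasures γ ν₀ P)
    (hρ : ρ ∈ occMeasures γ ν₀ P) : LinearMap.adjoint (shapingMap γ P) (μ - ρ) = 0 := by
  rw [map_sub, hμ.2, hρ.2, sub_self]

/-- Normalized constant rewards are potential shapings under every transition law. -/
theorem exists_unit_mem_potentialShaping [Nonempty S] [Nonempty A] (hγ1 : γ < 1) :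
    ∃ e : EuclideanSpace ℝ (S × A), ‖e‖ = 1 ∧ ∀ P : TransitionLaw S A, e ∈ potentialShaping γ P := by
  let o : EuclideanSpace ℝ (S × A) := WithLp.toLp 2 fun _ => 1
  have ho : o ≠ 0 := by
    obtain ⟨x⟩ := (inferInstance : Nonempty (S × A))
    intro h
    have := congrArg (fun v : EuclideanSpace ℝ (S × A) => v x) h
    simp [o] at this
  have hmem (P : TransitionLaw S A) : o ∈ potentialShaping γ P := by
    -- Each row of `P` sums to 1, so a constant potential is multiplied by `1 - γ`.
    refine ⟨WithLp.toLp 2 fun _ => (1 - γ)⁻¹, ?_⟩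
    ext x
    simp only [shapingMap, LinearMap.coe_mk, AddHom.coe_mk, ← Finset.sum_mul, stdSimplex.sum_eq_one, o]
    have : 1 - γ ≠ 0 := by linarith
    field_simp
  exact ⟨‖o‖⁻¹ • o, norm_smul_inv_norm ho, fun P => Submodule.smul_mem _ _ (hmem P)⟩

end OccupancyMeasures

/-! ### The gradient of `h̄` and its blow-up at the boundary. -/

section RegularizerGradient

variable {S A : Type*} [Fintype A]

theorem continuous_stateMarginal (s : S) :
    Continuous fun μ : EuclideanSpace ℝ (S × A) => stateMarginal μ s := by
  unfold stateMarginal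
  fun_prop

theorem stateMarginal_add_smul (μ ρ : EuclideanSpace ℝ (S × A)) (t : ℝ) (s : S) :
    stateMarginal (μ + t • ρ) s = stateMarginal μ s + t * stateMarginal ρ s := by
  simp [stateMarginal, Finset.sum_add_distrib, Finset.mul_sum]

theorem stateMarginal_pos [Nonempty A] {μ : EuclideanSpace ℝ (S × A)} (hμ : ∀ x, 0 < μ x) (s : S) :
    0 < stateMarginal μ s :=
  Finset.sum_pos (fun a _ => hμ (s, a)) Finset.univ_nonempty

theorem policyOf_apply {μ : EuclideanSpace ℝ (S × A)} {s : S} (hs : 0 < stateMarginal μ s) (a : A) :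
    policyOf μ s a = μ (s, a) / stateMarginal μ s := by
  simp [policyOf, hs]

theorem sum_policyOf {μ : EuclideanSpace ℝ (S × A)} {s : S} (hs : 0 < stateMarginal μ s) :
    ∑ a, policyOf μ s a = 1 := by
  simp only [policyOf_apply hs, ← Finset.sum_div]
  exact div_self hs.ne'

theorem policyOf_mem_simplex {μ : EuclideanSpace ℝ (S × A)} (hμ : ∀ x, 0 ≤ μ x) {s : S}
    (hs : 0 < stateMarginal μ s) : policyOf μ s ∈ simplex A := by
  refine ⟨fun a => ?_, sum_policyOf hs⟩
  rw [policyOf_apply hs]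
  exact div_nonneg (hμ _) hs.le

theorem policyOf_mem_interior [Nonempty A] {X : Set (EuclideanSpace ℝ A)}
    {h : EuclideanSpace ℝ A → ℝ} (hreg : IsRegularizer X h) {μ : EuclideanSpace ℝ (S × A)}
    (hμ : ∀ x, 0 < μ x) (s : S) : policyOf μ s ∈ interior X := by
  have hs := stateMarginal_pos hμ s
  refine hreg.relint_subset (mem_intrinsicInterior_simplex (fun a => ?_) (sum_policyOf hs))
  rw [policyOf_apply hs]
  exact div_pos (hμ _) hs

theorem toLp_eq_smul_policyOf {μ : EuclideanSpace ℝ (S × A)} {s : S}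
    (hs : 0 < stateMarginal μ s) :
    (WithLp.toLp 2 (fun a => μ (s, a)) : EuclideanSpace ℝ A) = stateMarginal μ s • policyOf μ s := by
  ext a
  simp only [PiLp.smul_apply, smul_eq_mul, policyOf_apply hs]
  exact (mul_div_cancel₀ _ hs.ne').symm

variable [Fintype S]

theorem differentiableAt_policyOf {μ : EuclideanSpace ℝ (S × A)} {s : S}
    (hs : 0 < stateMarginal μ s) : DifferentiableAt ℝ (fun ρ => policyOf ρ s) μ := by
  rw [differentiableAt_euclidean]
  intro a
  have h1 : DifferentiableAt ℝ (fun ρ : EuclideanSpace ℝ (S × A) =>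
      ρ (s, a) / stateMarginal ρ s) μ := by
    unfold stateMarginal at *
    fun_prop (disch := exact hs.ne')
  refine h1.congr_of_eventuallyEq ?_
  filter_upwards [(continuous_stateMarginal s).continuousAt.eventually (lt_mem_nhds hs)] with ρ hρ
  exact policyOf_apply hρ a

theorem differentiableAt_occReg [Nonempty A] {X : Set (EuclideanSpace ℝ A)}
    {h : EuclideanSpace ℝ A → ℝ} (hreg : IsRegularizer X h) (hsteep : IsSteep X h)
    {μ : EuclideanSpace ℝ (S × A)} (hμ : ∀ x, 0 < μ x) : DifferentiableAt ℝ (occReg h) μ := by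
  unfold occReg
  refine DifferentiableAt.fun_sum fun x _ => DifferentiableAt.mul (by fun_prop) ?_
  exact DifferentiableAt.comp (g := h) μ
    (hsteep.differentiableAt _ (policyOf_mem_interior hreg hμ x.1))
    (differentiableAt_policyOf (stateMarginal_pos hμ x.1))

theorem occReg_eq_sum (h : EuclideanSpace ℝ A → ℝ) (μ : EuclideanSpace ℝ (S × A)) :
    occReg h μ = ∑ s, stateMarginal μ s * h (policyOf μ s) := by
  simp only [occReg, Fintype.sum_prod_type, stateMarginal, Finset.sum_mul]

theorem hasDerivAt_policyOf {μ : EuclideanSpace ℝ (S × A)} {s : S} (hs : 0 < stateMarginal μ s)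
    (ρ : EuclideanSpace ℝ (S × A)) :
    HasDerivAt (fun t : ℝ => policyOf (μ + t • ρ) s)
      ((stateMarginal μ s)⁻¹ • (WithLp.toLp 2 (fun a => ρ (s, a)) -
        stateMarginal ρ s • policyOf μ s)) 0 := by
  have hline : HasDerivAt (fun t : ℝ => μ + t • ρ) ρ 0 := by
    simpa using ((hasDerivAt_id (0 : ℝ)).smul_const ρ).const_add μ
  have hd : DifferentiableAt ℝ (fun t : ℝ => policyOf (μ + t • ρ) s) 0 := by
    have h1 : DifferentiableAt ℝ (fun ρ' => policyOf ρ' s) (μ + (0 : ℝ) • ρ) := by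
      simpa using differentiableAt_policyOf hs
    exact DifferentiableAt.comp (g := fun ρ' => policyOf ρ' s) (0 : ℝ) h1 hline.differentiableAt
  have heq : deriv (fun t : ℝ => policyOf (μ + t • ρ) s) 0 = (stateMarginal μ s)⁻¹ •
      (WithLp.toLp 2 (fun a => ρ (s, a)) - stateMarginal ρ s • policyOf μ s) := by
    ext a
    have h1 : HasDerivAt (fun t : ℝ => policyOf (μ + t • ρ) s a)
        (deriv (fun t : ℝ => policyOf (μ + t • ρ) s) 0 a) 0 :=
      (EuclideanSpace.proj a : EuclideanSpace ℝ A →L[ℝ] ℝ).hasFDerivAt.comp_hasDerivAt (0 : ℝ)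
        hd.hasDerivAt
    have h2 : HasDerivAt (fun t : ℝ => (μ (s, a) + t * ρ (s, a)) /
        (stateMarginal μ s + t * stateMarginal ρ s))
        ((ρ (s, a) * stateMarginal μ s - μ (s, a) * stateMarginal ρ s) / stateMarginal μ s ^ 2)
        0 := by
      have hn : HasDerivAt (fun t : ℝ => μ (s, a) + t * ρ (s, a)) (ρ (s, a)) 0 := by
        simpa using ((hasDerivAt_id (0 : ℝ)).mul_const (ρ (s, a))).const_add (μ (s, a))
      have hm : HasDerivAt (fun t : ℝ => stateMarginal μ s + t * stateMarginal ρ s)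
          (stateMarginal ρ s) 0 := by
        simpa using
          ((hasDerivAt_id (0 : ℝ)).mul_const (stateMarginal ρ s)).const_add (stateMarginal μ s)
      simpa using hn.fun_div hm (by simpa using hs.ne')
    have hev : (fun t : ℝ => policyOf (μ + t • ρ) s a) =ᶠ[𝓝 0] fun t : ℝ =>
        (μ (s, a) + t * ρ (s, a)) / (stateMarginal μ s + t * stateMarginal ρ s) := by
      have hc : Continuous fun t : ℝ => stateMarginal (μ + t • ρ) s :=
        (continuous_stateMarginal s).comp (by fun_prop)
      have h0 : 0 < stateMarginal (μ + (0 : ℝ) • ρ) s := by simpa using hs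
      filter_upwards [hc.continuousAt.eventually (lt_mem_nhds h0)] with t ht
      rw [policyOf_apply ht, stateMarginal_add_smul]
      simp
    rw [h1.unique (h2.congr_of_eventuallyEq hev)]
    simp only [PiLp.smul_apply, PiLp.sub_apply, smul_eq_mul, policyOf_apply hs]
    have := hs.ne'
    field_simp
  rw [← heq]
  exact hd.hasDerivAt

/-- By `occReg_eq_sum`, `h̄` is a sum over states of perspectives `ν h(· / ν)` of `h`. Each summand
on the right is, for positive `ρ`, the state mass times the tangent of `h` at one policy evaluated
at the other. -/
theorem inner_gradient_occReg [Nonempty A] {X : Set (EuclideanSpace ℝ A)}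
    {h : EuclideanSpace ℝ A → ℝ} (hreg : IsRegularizer X h) (hsteep : IsSteep X h)
    {μ : EuclideanSpace ℝ (S × A)} (hμ : ∀ x, 0 < μ x) (ρ : EuclideanSpace ℝ (S × A)) :
    ⟪gradient (occReg h) μ, ρ⟫_ℝ = ∑ s, (stateMarginal ρ s * h (policyOf μ s) +
      ⟪gradient h (policyOf μ s),
        WithLp.toLp 2 (fun a => ρ (s, a)) - stateMarginal ρ s • policyOf μ s⟫_ℝ) := by
  have h1 := (differentiableAt_occReg hreg hsteep hμ).hasGradientAt.hasDerivAt_comp_add_smul ρ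
  refine h1.unique ?_
  simp only [occReg_eq_sum, stateMarginal_add_smul]
  refine HasDerivAt.fun_sum fun s _ => ?_
  have hs := stateMarginal_pos hμ s
  have hm : HasDerivAt (fun t : ℝ => stateMarginal μ s + t * stateMarginal ρ s)
      (stateMarginal ρ s) 0 := by
    simpa using
      ((hasDerivAt_id (0 : ℝ)).mul_const (stateMarginal ρ s)).const_add (stateMarginal μ s)
  have hh : HasFDerivAt h ((InnerProductSpace.toDual ℝ _) (gradient h (policyOf μ s)))
      (policyOf (μ + (0 : ℝ) • ρ) s) := by
    simpa using
      (hsteep.differentiableAt _ (policyOf_mem_interior hreg hμ s)).hasGradientAt.hasFDerivAt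
  have hc := hh.comp_hasDerivAt (0 : ℝ) (hasDerivAt_policyOf hs ρ)
  have hmul := hm.fun_mul hc
  simp only [zero_mul, add_zero, zero_smul, Function.comp_apply, InnerProductSpace.toDual_apply_apply,
    inner_smul_right] at hmul
  rwa [mul_inv_cancel_left₀ hs.ne'] at hmul

/-- Euler's identity for a function homogeneous of degree one. -/
theorem inner_gradient_occReg_self [Nonempty A] {X : Set (EuclideanSpace ℝ A)}
    {h : EuclideanSpace ℝ A → ℝ} (hreg : IsRegularizer X h) (hsteep : IsSteep X h)
    {μ : EuclideanSpace ℝ (S × A)} (hμ : ∀ x, 0 < μ x) :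
    ⟪gradient (occReg h) μ, μ⟫_ℝ = occReg h μ := by
  rw [inner_gradient_occReg hreg hsteep hμ, occReg_eq_sum]
  refine Finset.sum_congr rfl fun s _ => ?_
  rw [toLp_eq_smul_policyOf (stateMarginal_pos hμ s), sub_self, inner_zero_right, add_zero]

/-- Steepness of the regularizer passes to the occupancy measure regularizer. -/
theorem tendsto_inner_gradient_occReg_atBot [Nonempty A] {X : Set (EuclideanSpace ℝ A)}
    {h : EuclideanSpace ℝ A → ℝ} (hreg : IsRegularizer X h) (hsteep : IsSteep X h)
    {μ ρ : EuclideanSpace ℝ (S × A)} {u : ℕ → EuclideanSpace ℝ (S × A)}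
    (hu : ∀ n x, 0 < u n x) (hlim : Tendsto u atTop (𝓝 μ)) (hρ : ∀ x, 0 < ρ x)
    (hμ : ∀ x, 0 ≤ μ x) (hmarg : ∀ s, 0 < stateMarginal μ s) {x₀ : S × A} (hx₀ : μ x₀ = 0) :
    Tendsto (fun n => ⟪gradient (occReg h) (u n), ρ⟫_ℝ) atTop atBot := by
  have hcx : ConvexOn ℝ X h := hreg.strictConvexOn.convexOn
  have hdiff (ν : EuclideanSpace ℝ (S × A)) (hν : ∀ x, 0 < ν x) (s : S) :
      DifferentiableAt ℝ h (policyOf ν s) :=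
    hsteep.differentiableAt _ (policyOf_mem_interior hreg hν s)
  -- The constants depend only on the policy of `ρ`. Every state's term is bounded above, and the
  -- state of `x₀`, where the limit policy is on the boundary of the simplex, drives the sum to
  -- `-∞`.
  choose C c hc hbound using fun s : S => hcx.exists_add_inner_gradient_le_sub_norm
    (policyOf_mem_interior hreg hρ s) (hdiff ρ hρ s)
  have hfront : policyOf μ x₀.1 ∈ intrinsicFrontier ℝ (simplex A) := by
    refine mem_intrinsicFrontier_simplex (a := x₀.2) (policyOf_mem_simplex hμ (hmarg _)) ?_
    rw [policyOf_apply (hmarg _)]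
    simp [hx₀]
  have hpol : Tendsto (fun n => policyOf (u n) x₀.1) atTop (𝓝 (policyOf μ x₀.1)) :=
    (differentiableAt_policyOf (hmarg x₀.1)).continuousAt.tendsto.comp hlim
  have hnorm := hsteep.tendsto_norm_gradient _ hfront _
    (fun n => policyOf_mem_interior hreg (hu n) x₀.1) hpol
  have hk : 0 < stateMarginal ρ x₀.1 * c x₀.1 := mul_pos (stateMarginal_pos hρ _) (hc _)
  have hT : Tendsto (fun n => (∑ s, stateMarginal ρ s * C s) +
      -(stateMarginal ρ x₀.1 * c x₀.1 * ‖gradient h (policyOf (u n) x₀.1)‖)) atTop atBot :=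
    tendsto_atBot_add_const_left _ _ (tendsto_neg_atTop_atBot.comp (hnorm.const_mul_atTop hk))
  refine tendsto_atBot_mono (fun n => ?_) hT
  rw [inner_gradient_occReg hreg hsteep (hu n)]
  have hle (s : S) : stateMarginal ρ s * h (policyOf (u n) s) +
      ⟪gradient h (policyOf (u n) s),
        WithLp.toLp 2 (fun a => ρ (s, a)) - stateMarginal ρ s • policyOf (u n) s⟫_ℝ ≤
      stateMarginal ρ s * C s - stateMarginal ρ s * c s * ‖gradient h (policyOf (u n) s)‖ := by
    have hs := stateMarginal_pos hρ s
    rw [toLp_eq_smul_policyOf hs, ← smul_sub, inner_smul_right]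
    have := mul_le_mul_of_nonneg_left (hbound s _
      (interior_subset (policyOf_mem_interior hreg (hu n) s)) (hdiff _ (hu n) s)) hs.le
    linarith
  refine (Finset.sum_le_sum fun s _ => hle s).trans ?_
  rw [Finset.sum_sub_distrib, ← sub_eq_add_neg]
  refine sub_le_sub_left ?_ _
  exact Finset.single_le_sum (f := fun s => stateMarginal ρ s * c s *
    ‖gradient h (policyOf (u n) s)‖) (fun s _ => mul_nonneg (mul_nonneg
    (stateMarginal_pos hρ s).le (hc s).le) (norm_nonneg _)) (Finset.mem_univ x₀.1)

end RegularizerGradient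

/-- Mixing with a positive vector stays in the positive orthant. -/
theorem mix_pos {ι : Type*} {μ ρ : EuclideanSpace ℝ ι} (hμ : ∀ x, 0 ≤ μ x) (hρ : ∀ x, 0 < ρ x) {t : ℝ}
    (ht0 : 0 < t) (ht1 : t ≤ 1) (x : ι) : 0 < ((1 - t) • μ + t • ρ) x := by
  simp only [PiLp.add_apply, PiLp.smul_apply, smul_eq_mul]
  exact add_pos_of_nonneg_of_pos (mul_nonneg (by linarith) (hμ x)) (mul_pos ht0 (hρ x))

/-! ### Interior optima and suboptimality bounds. -/

section OptimalOccupancy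

variable {S A : Type*} [Fintype S] [Fintype A] {γ : ℝ} {ν₀ : stdSimplex ℝ S}
  {X : Set (EuclideanSpace ℝ A)} {h : EuclideanSpace ℝ A → ℝ} {η : ℝ} {P : TransitionLaw S A}

theorem OccStronglyConvex.objective_le (hη : 0 < η) (hconv : OccStronglyConvex γ ν₀ h η P)
    (r : EuclideanSpace ℝ (S × A)) {μ ρ : EuclideanSpace ℝ (S × A)} (hμ : μ ∈ occMeasures γ ν₀ P)
    (hpos : ∀ x, 0 < μ x) (hρ : ρ ∈ occMeasures γ ν₀ P) :
    objective h r ρ ≤ objective h r μ + ⟪r - gradient (occReg h) μ, ρ - μ⟫_ℝ := by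
  have h1 := hconv μ (mem_intrinsicInterior_occMeasures hμ hpos) ρ hρ
  have h2 : 0 ≤ η / 2 * ‖ρ - μ‖ ^ 2 := by positivity
  simp only [objective]
  rw [inner_sub_left, inner_sub_right r]
  linarith

theorem continuousAt_objective [Nonempty A] (hreg : IsRegularizer X h) (hsteep : IsSteep X h)
    (r : EuclideanSpace ℝ (S × A)) {μ : EuclideanSpace ℝ (S × A)} (hpos : ∀ x, 0 < μ x) :
    ContinuousAt (objective h r) μ := by
  unfold objective
  exact ContinuousAt.sub (by fun_prop) (differentiableAt_occReg hreg hsteep hpos).continuousAt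

/-- The objective is concave along segments between positive occupancy measures, and this extends to
limits at one end point. -/
theorem le_objective_mix_of_tendsto [Nonempty A] (hreg : IsRegularizer X h) (hsteep : IsSteep X h) (hη : 0 < η)
    (hconv : OccStronglyConvex γ ν₀ h η P) (r : EuclideanSpace ℝ (S × A))
    {μ ρ : EuclideanSpace ℝ (S × A)} {u : ℕ → EuclideanSpace ℝ (S × A)} {m : ℝ}
    (hu : ∀ n, u n ∈ occMeasures γ ν₀ P) (hlim : Tendsto u atTop (𝓝 μ))
    (hval : Tendsto (fun n => objective h r (u n)) atTop (𝓝 m))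
    (hμ : μ ∈ occMeasures γ ν₀ P) (hρ : ρ ∈ occMeasures γ ν₀ P) (hρpos : ∀ x, 0 < ρ x)
    {t : ℝ} (ht0 : 0 < t) (ht1 : t ≤ 1) :
    (1 - t) * m + t * objective h r ρ ≤ objective h r ((1 - t) • μ + t • ρ) := by
  have hzlim : Tendsto (fun n => (1 - t) • u n + t • ρ) atTop (𝓝 ((1 - t) • μ + t • ρ)) :=
    (hlim.const_smul _).add_const _
  -- The mixture is positive even if `μ` is not, so no continuity at `μ` is required.
  have h1 := ((continuousAt_objective hreg hsteep r (mix_pos hμ.1 hρpos ht0 ht1)).tendsto.comp hzlim)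
  refine le_of_tendsto_of_tendsto ((hval.const_mul (1 - t)).add_const _) h1
    (Eventually.of_forall fun n => ?_)
  have hz : (1 - t) • u n + t • ρ ∈ occMeasures γ ν₀ P :=
    convex_occMeasures (hu n) hρ (by linarith) ht0.le (by ring)
  have hzpos := mix_pos (hu n).1 hρpos ht0 ht1
  have h2 := hconv.objective_le hη r hz hzpos (hu n)
  have h3 := hconv.objective_le hη r hz hzpos hρ
  set z := (1 - t) • u n + t • ρ with hzdef
  set g := r - gradient (occReg h) z
  -- The mixture is the barycentre of its end points, so the linear terms of the two tangent bounds
  -- cancel.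
  have h4 : (1 - t) * ⟪g, u n - z⟫_ℝ + t * ⟪g, ρ - z⟫_ℝ = 0 := by
    rw [← real_inner_smul_right, ← real_inner_smul_right, ← inner_add_right]
    have : (1 - t) • (u n - z) + t • (ρ - z) = 0 := by rw [hzdef]; module
    rw [this, inner_zero_right]
  have h5 := mul_le_mul_of_nonneg_left h2 (sub_nonneg.2 ht1)
  have h6 := mul_le_mul_of_nonneg_left h3 ht0.le
  simp only [Function.comp_apply]
  nlinarith

/-- A limit of maximizing positive occupancy measures is positive, by steepness. -/
theorem pos_of_tendsto_of_maximizing [Nonempty A] (hreg : IsRegularizer X h) (hsteep : IsSteep X h)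
    (hexp : Exploration γ ν₀ P) (hη : 0 < η) (hconv : OccStronglyConvex γ ν₀ h η P)
    (r : EuclideanSpace ℝ (S × A)) {μ ρ : EuclideanSpace ℝ (S × A)}
    {u : ℕ → EuclideanSpace ℝ (S × A)} {m : ℝ} (hu : ∀ n, u n ∈ occMeasures γ ν₀ P)
    (hlim : Tendsto u atTop (𝓝 μ)) (hval : Tendsto (fun n => objective h r (u n)) atTop (𝓝 m))
    (hm : ∀ ξ ∈ occMeasures γ ν₀ P, (∀ x, 0 < ξ x) → objective h r ξ ≤ m)
    (hμ : μ ∈ occMeasures γ ν₀ P) (hρ : ρ ∈ occMeasures γ ν₀ P) (hρpos : ∀ x, 0 < ρ x)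
    (x : S × A) : 0 < μ x := by
  by_contra hx
  have hx0 : μ x = 0 := le_antisymm (not_lt.1 hx) (hμ.1 x)
  obtain ⟨νmin, hν, hmin⟩ := hexp
  let t : ℕ → ℝ := fun n => 1 / ((n : ℝ) + 2)
  have ht0 (n : ℕ) : 0 < t n := by positivity
  have ht1 (n : ℕ) : t n < 1 := by
    rw [div_lt_one (by positivity)]
    linarith [(Nat.cast_nonneg n : (0 : ℝ) ≤ n)]
  have htlim : Tendsto t atTop (𝓝 0) :=
    tendsto_const_nhds.div_atTop (tendsto_atTop_add_const_right _ _ tendsto_natCast_atTop_atTop)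
  let y : ℕ → EuclideanSpace ℝ (S × A) := fun n => (1 - t n) • μ + t n • ρ
  have hy (n : ℕ) : y n ∈ occMeasures γ ν₀ P :=
    convex_occMeasures hμ hρ (by linarith [ht1 n]) (ht0 n).le (by ring)
  have hypos (n : ℕ) (z : S × A) : 0 < y n z := mix_pos hμ.1 hρpos (ht0 n) (ht1 n).le z
  have hylim : Tendsto y atTop (𝓝 μ) := by
    have h1 : Tendsto y atTop (𝓝 ((1 - (0 : ℝ)) • μ + (0 : ℝ) • ρ)) :=
      ((htlim.const_sub 1).smul_const μ).add (htlim.smul_const ρ)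
    simpa using h1
  have hbot := tendsto_inner_gradient_occReg_atBot hreg hsteep hypos hylim hρpos hμ.1
    (fun s => hν.trans_le (hmin μ hμ s)) hx0
  obtain ⟨n, hn⟩ := (hbot.eventually (eventually_lt_atBot (⟪r, ρ⟫_ℝ - m))).exists
  set g := r - gradient (occReg h) (y n) with hg
  -- By Euler's identity this slope is `⟪r, ρ⟫ - ⟪∇h̄(y n), ρ⟫ - J(r, y n)`, which exceeds `m - J(r,
  -- y n) ≥ 0` by the choice of `n`.
  have hpos : 0 < ⟪g, ρ - y n⟫_ℝ := by
    have h1 := inner_gradient_occReg_self hreg hsteep (hypos n)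
    have h2 := hm _ (hy n) (hypos n)
    rw [objective] at h2
    rw [hg, inner_sub_left, inner_sub_right, inner_sub_right, h1]
    linarith
  have hdir : 0 < ⟪g, ρ - μ⟫_ℝ := by
    have h1 : ρ - y n = (1 - t n) • (ρ - μ) := by simp only [y]; module
    rw [h1, inner_smul_right] at hpos
    exact pos_of_mul_pos_right hpos (by linarith [ht1 n])
  -- Along the segment towards `μ`, the values at `y k` are at least a mixture tending to `m`, but
  -- at most the tangent at `y n`. In the limit `m ≤ J(r, y n) - t n * ⟪g, ρ - μ⟫ < m`.
  have hle (k : ℕ) : (1 - t k) * m + t k * objective h r ρ ≤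
      objective h r (y n) + (t k - t n) * ⟪g, ρ - μ⟫_ℝ := by
    refine (le_objective_mix_of_tendsto hreg hsteep hη hconv r hu hlim hval hμ hρ hρpos (ht0 k)
      (ht1 k).le).trans ?_
    refine (hconv.objective_le hη r (hy n) (hypos n) (hy k)).trans (le_of_eq ?_)
    have h1 : y k - y n = (t k - t n) • (ρ - μ) := by simp only [y]; module
    rw [h1, inner_smul_right]
  have hlim1 : Tendsto (fun k => (1 - t k) * m + t k * objective h r ρ) atTop (𝓝 m) := by
    have h1 := ((htlim.const_sub 1).mul_const m).add (htlim.mul_const (objective h r ρ))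
    simpa using h1
  have hlim2 : Tendsto (fun k => objective h r (y n) + (t k - t n) * ⟪g, ρ - μ⟫_ℝ) atTop
      (𝓝 (objective h r (y n) + (0 - t n) * ⟪g, ρ - μ⟫_ℝ)) :=
    ((htlim.sub_const (t n)).mul_const _).const_add _
  have h1 := le_of_tendsto_of_tendsto' hlim1 hlim2 hle
  have h2 := hm _ (hy n) (hypos n)
  nlinarith [mul_pos (ht0 n) hdir]

/-- Competitors are restricted to positive measures, where the objective is continuous; a tangent at
one of them bounds it above on the compact `ℳ_P`. -/
theorem exists_pos_maximizer [Nonempty A] (hγ0 : 0 < γ) (hγ1 : γ < 1) (hreg : IsRegularizer X h)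
    (hsteep : IsSteep X h) (hexp : Exploration γ ν₀ P) (hη : 0 < η)
    (hconv : OccStronglyConvex γ ν₀ h η P) (r : EuclideanSpace ℝ (S × A)) :
    ∃ μ ∈ occMeasures γ ν₀ P, (∀ x, 0 < μ x) ∧
      ∀ ξ ∈ occMeasures γ ν₀ P, (∀ x, 0 < ξ x) → objective h r ξ ≤ objective h r μ := by
  obtain ⟨ρ, hρ, hρpos⟩ := exists_pos_mem_occMeasures hγ0 hγ1 hexp
  let F : Set (EuclideanSpace ℝ (S × A)) := {ξ | ξ ∈ occMeasures γ ν₀ P ∧ ∀ x, 0 < ξ x}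
  have hbdd : BddAbove (objective h r '' F) := by
    have h1 : ContinuousOn (fun ξ => objective h r ρ + ⟪r - gradient (occReg h) ρ, ξ - ρ⟫_ℝ)
        (occMeasures γ ν₀ P) := by fun_prop
    obtain ⟨B, hB⟩ := (isCompact_occMeasures hγ1).bddAbove_image h1
    refine ⟨B, ?_⟩
    rintro _ ⟨ξ, hξ, rfl⟩
    exact (hconv.objective_le hη r hρ hρpos hξ.1).trans (hB ⟨ξ, hξ.1, rfl⟩)
  obtain ⟨v, -, hv, hvmem⟩ := exists_seq_tendsto_sSup (S := objective h r '' F)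
    ⟨_, ρ, ⟨hρ, hρpos⟩, rfl⟩ hbdd
  choose w hwF hwv using hvmem
  obtain ⟨μ, hμ, φ, hφ, hlim⟩ := (isCompact_occMeasures hγ1).tendsto_subseq fun n => (hwF n).1
  have hval : Tendsto (fun n => objective h r ((w ∘ φ) n)) atTop
      (𝓝 (sSup (objective h r '' F))) := by
    simpa only [Function.comp_def, hwv] using hv.comp hφ.tendsto_atTop
  have hm : ∀ ξ ∈ occMeasures γ ν₀ P, (∀ x, 0 < ξ x) →
      objective h r ξ ≤ sSup (objective h r '' F) :=
    fun ξ hξ hξpos => le_csSup hbdd ⟨ξ, ⟨hξ, hξpos⟩, rfl⟩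
  have hμpos := pos_of_tendsto_of_maximizing hreg hsteep hexp hη hconv r
    (fun n => (hwF (φ n)).1) hlim hval hm hμ hρ hρpos
  refine ⟨μ, hμ, hμpos, ?_⟩
  rwa [tendsto_nhds_unique
    ((continuousAt_objective hreg hsteep r hμpos).tendsto.comp hlim) hval]

/-- The optimality condition of the regularized problem has an interior solution. -/
theorem exists_stationary_occMeasure [Nonempty A] (hγ0 : 0 < γ) (hγ1 : γ < 1) (hreg : IsRegularizer X h)
    (hsteep : IsSteep X h) (hexp : Exploration γ ν₀ P) (hη : 0 < η)
    (hconv : OccStronglyConvex γ ν₀ h η P) (r : EuclideanSpace ℝ (S × A)) :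
    ∃ μ ∈ occMeasures γ ν₀ P, (∀ x, 0 < μ x) ∧
      r - gradient (occReg h) μ ∈ potentialShaping γ P := by
  obtain ⟨μ, hμ, hpos, hmax⟩ := exists_pos_maximizer hγ0 hγ1 hreg hsteep hexp hη hconv r
  refine ⟨μ, hμ, hpos, mem_potentialShaping_iff.2 fun d hd => ?_⟩
  have hderiv : HasDerivAt (fun t : ℝ => objective h r (μ + t • d))
      (⟪r, d⟫_ℝ - ⟪gradient (occReg h) μ, d⟫_ℝ) 0 := by
    have h1 := (differentiableAt_occReg hreg hsteep hpos).hasGradientAt.hasDerivAt_comp_add_smul d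
    have h2 : HasDerivAt (fun t : ℝ => ⟪r, μ + t • d⟫_ℝ) ⟪r, d⟫_ℝ 0 := by
      simp only [inner_add_right, inner_smul_right]
      simpa using ((hasDerivAt_id (0 : ℝ)).mul_const ⟪r, d⟫_ℝ).const_add ⟪r, μ⟫_ℝ
    exact h2.fun_sub h1
  -- Positivity makes small moves along both `d` and `-d` admissible, so the derivative along `d`
  -- vanishes.
  have hloc : IsLocalMax (fun t : ℝ => objective h r (μ + t • d)) 0 := by
    have hev : ∀ᶠ t : ℝ in 𝓝 0, ∀ x, 0 < (μ + t • d) x := by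
      refine eventually_all.2 fun x => ?_
      have hc : Continuous fun t : ℝ => (μ + t • d) x := by fun_prop
      exact hc.continuousAt.eventually (lt_mem_nhds (by simpa using hpos x))
    filter_upwards [hev] with t ht
    simp only [zero_smul, add_zero]
    exact hmax _ ⟨fun x => (ht x).le, by rw [map_add, map_smul, hd, smul_zero, add_zero, hμ.2]⟩ ht
  rw [real_inner_comm, inner_sub_left]
  exact hloc.hasDerivAt_eq_zero hderiv

theorem inner_gradient_eq_of_stationary {r μ ρ : EuclideanSpace ℝ (S × A)}
    (hμ : μ ∈ occMeasures γ ν₀ P) (hstat : r - gradient (occReg h) μ ∈ potentialShaping γ P)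
    (hρ : ρ ∈ occMeasures γ ν₀ P) : ⟪gradient (occReg h) μ, ρ - μ⟫_ℝ = ⟪r, ρ - μ⟫_ℝ := by
  have h1 := mem_potentialShaping_iff.1 hstat _ (adjoint_sub_eq_zero hρ hμ)
  rw [real_inner_comm, inner_sub_left] at h1
  linarith

/-- Stationarity lets `r` replace the gradient when paired with `ρ - μ`. The competitor `ρ` may lie
on the boundary, so optimality among positive measures extends to all of `ℳ_P`. -/
theorem OccStronglyConvex.objective_add_le_of_stationary (hconv : OccStronglyConvex γ ν₀ h η P)
    {r μ ρ : EuclideanSpace ℝ (S × A)} (hμ : μ ∈ occMeasures γ ν₀ P) (hpos : ∀ x, 0 < μ x)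
    (hstat : r - gradient (occReg h) μ ∈ potentialShaping γ P) (hρ : ρ ∈ occMeasures γ ν₀ P) :
    objective h r ρ + η / 2 * ‖ρ - μ‖ ^ 2 ≤ objective h r μ := by
  have h1 := hconv μ (mem_intrinsicInterior_occMeasures hμ hpos) ρ hρ
  rw [inner_gradient_eq_of_stationary hμ hstat hρ, inner_sub_right] at h1
  simp only [objective]
  linarith

theorem optOcc_eq_singleton (hη : 0 < η) (hconv : OccStronglyConvex γ ν₀ h η P)
    {r μ : EuclideanSpace ℝ (S × A)} (hμ : μ ∈ occMeasures γ ν₀ P) (hpos : ∀ x, 0 < μ x)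
    (hstat : r - gradient (occReg h) μ ∈ potentialShaping γ P) : optOcc γ ν₀ h P r = {μ} := by
  have hle {ρ : EuclideanSpace ℝ (S × A)} (hρ : ρ ∈ occMeasures γ ν₀ P) :=
    hconv.objective_add_le_of_stationary hμ hpos hstat hρ
  ext ρ
  rw [Set.mem_singleton_iff]
  constructor
  · rintro ⟨hρ, hmax⟩
    have h1 := hle hρ
    have h2 : objective h r μ ≤ objective h r ρ := hmax hμ
    have h3 : ‖ρ - μ‖ ^ 2 ≤ 0 := by nlinarith
    exact sub_eq_zero.1 (norm_eq_zero.1 (pow_eq_zero_iff two_ne_zero |>.1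
      (le_antisymm h3 (sq_nonneg _))))
  · rintro rfl
    refine ⟨hμ, fun ξ hξ => ?_⟩
    have h1 := hle hξ
    have h2 : 0 ≤ η / 2 * ‖ξ - ρ‖ ^ 2 := by positivity
    exact le_trans (by linarith) h1

/-- Strong convexity of the regularizer makes the suboptimality quadratic in the occupancy
measures. -/
theorem OccStronglyConvex.le_subOpt (hη : 0 < η) (hconv : OccStronglyConvex γ ν₀ h η P)
    {r μ ρ : EuclideanSpace ℝ (S × A)} (hμ : μ ∈ occMeasures γ ν₀ P) (hpos : ∀ x, 0 < μ x)
    (hstat : r - gradient (occReg h) μ ∈ potentialShaping γ P) (hρ : ρ ∈ occMeasures γ ν₀ P) :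
    η / 2 * ‖ρ - μ‖ ^ 2 ≤ subOpt γ ν₀ h P r ρ := by
  have hmax : μ ∈ optOcc γ ν₀ h P r := by
    rw [optOcc_eq_singleton hη hconv hμ hpos hstat]; rfl
  have hbdd : BddAbove (objective h r '' occMeasures γ ν₀ P) :=
    ⟨objective h r μ, by rintro _ ⟨ξ, hξ, rfl⟩; exact hmax.2 hξ⟩
  have h1 : objective h r μ ≤ sSup (objective h r '' occMeasures γ ν₀ P) :=
    le_csSup hbdd ⟨μ, hμ, rfl⟩
  have h2 := hconv.objective_add_le_of_stationary hμ hpos hstat hρ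
  rw [subOpt]
  linarith

/-- Optimizing a reward that is close modulo potential shaping is nearly optimal. -/
theorem OccStronglyConvex.subOpt_le (hη : 0 < η) (hconv : OccStronglyConvex γ ν₀ h η P)
    {r r' μ : EuclideanSpace ℝ (S × A)} (hμ : μ ∈ occMeasures γ ν₀ P) (hpos : ∀ x, 0 < μ x)
    (hstat : r' - gradient (occReg h) μ ∈ potentialShaping γ P) {x : EuclideanSpace ℝ (S × A)}
    (hx : r - r' - x ∈ potentialShaping γ P) :
    subOpt γ ν₀ h P r μ ≤ ‖x‖ ^ 2 / (2 * η) := by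
  rw [subOpt, sub_le_iff_le_add]
  refine csSup_le ⟨_, μ, hμ, rfl⟩ ?_
  rintro _ ⟨ρ, hρ, rfl⟩
  have h1 := hconv.objective_add_le_of_stationary hμ hpos hstat hρ
  have h2 := mem_potentialShaping_iff.1 hx _ (adjoint_sub_eq_zero hρ hμ)
  rw [real_inner_comm, inner_sub_left, inner_sub_left, inner_sub_right r, inner_sub_right r'] at h2
  have h3 := real_inner_le_norm x (ρ - μ)
  simp only [objective] at h1 ⊢
  -- The maximum of a concave quadratic in `‖ρ - μ‖`, attained at `‖x‖ / η`.
  have h4 : ‖x‖ * ‖ρ - μ‖ - η / 2 * ‖ρ - μ‖ ^ 2 ≤ ‖x‖ ^ 2 / (2 * η) := by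
    rw [le_div_iff₀ (by positivity)]
    nlinarith [sq_nonneg (‖x‖ - η * ‖ρ - μ‖)]
  linarith

end OptimalOccupancy

/-! ### Dual strong convexity and transfer. -/

section Transfer

variable {S A : Type*} [Fintype S] [Fintype A] {γ : ℝ} {ν₀ : stdSimplex ℝ S}
  {X : Set (EuclideanSpace ℝ A)} {h : EuclideanSpace ℝ A → ℝ} {η : ℝ} {P : TransitionLaw S A}

theorem exists_isDualConvexityConst [Nonempty A] (hγ0 : 0 < γ) (hγ1 : γ < 1) (hreg : IsRegularizer X h)
    (hsteep : IsSteep X h) (hexp : Exploration γ ν₀ P) (hη : 0 < η)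
    (hconv : OccStronglyConvex γ ν₀ h η P) (hlip : OccLocallyLipschitzGradient γ ν₀ h P)
    {R : Set (EuclideanSpace ℝ (S × A))} (hR : IsCompact R) :
    ∃ σ : ℝ, 0 < σ ∧ IsDualConvexityConst γ ν₀ h R P σ := by
  choose f hf hfpos hfstat using
    exists_stationary_occMeasure hγ0 hγ1 hreg hsteep hexp hη hconv
  have hfcont : Continuous f := by
    -- Adding the growth bounds at the two optima gives `η ‖f r - f r'‖² ≤ ⟪r - r', f r - f r'⟫`.
    refine (LipschitzWith.of_dist_le' (K := η⁻¹) fun r r' => ?_).continuous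
    have h1 := hconv.objective_add_le_of_stationary (hf r) (hfpos r) (hfstat r) (hf r')
    have h2 := hconv.objective_add_le_of_stationary (hf r') (hfpos r') (hfstat r') (hf r)
    have h3 := real_inner_le_norm (r - r') (f r - f r')
    rw [inner_sub_left, inner_sub_right, inner_sub_right] at h3
    rw [norm_sub_rev] at h1
    simp only [objective] at h1 h2
    rw [dist_eq_norm, dist_eq_norm, le_inv_mul_iff₀ hη]
    rcases (norm_nonneg (f r - f r')).eq_or_lt with h0 | h0
    · rw [← h0, mul_zero]
      exact norm_nonneg _
    · refine le_of_mul_le_mul_right ?_ h0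
      nlinarith
  -- By compactness each coordinate of the optima is bounded below by a positive constant over `R`;
  -- these bounds cut out the closed convex set on which the gradient is Lipschitz.
  choose δ hδ hδle using fun x : S × A => hR.exists_forall_le' (f := fun r => f r x) (a := 0)
    (by fun_prop) fun r _ => hfpos r x
  have hKclosed : IsClosed (occMeasures γ ν₀ P ∩ ⋂ x, {μ | δ x ≤ μ x}) :=
    isClosed_occMeasures.inter (isClosed_iInter fun x => isClosed_le continuous_const (by fun_prop))
  have hKconvex : Convex ℝ (occMeasures γ ν₀ P ∩ ⋂ x, {μ | δ x ≤ μ x}) := by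
    refine convex_occMeasures.inter (convex_iInter fun x => ?_)
    intro μ hμ ρ hρ a b ha hb hab
    exact convex_Ici (δ x) hμ hρ ha hb hab
  have hKsub : (occMeasures γ ν₀ P ∩ ⋂ x, {μ | δ x ≤ μ x}) ⊆
      intrinsicInterior ℝ (occMeasures γ ν₀ P) := fun μ hμ =>
    mem_intrinsicInterior_occMeasures hμ.1 fun x => (hδ x).trans_le (Set.mem_iInter.1 hμ.2 x)
  have hKmem {r : EuclideanSpace ℝ (S × A)} (hr : r ∈ R) :
      f r ∈ occMeasures γ ν₀ P ∩ ⋂ x, {μ | δ x ≤ μ x} :=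
    ⟨hf r, Set.mem_iInter.2 fun x => hδle x r hr⟩
  obtain ⟨C, hC, hCle⟩ := hlip _ hKsub hKclosed hKconvex
  -- Growth gives `η / 2` times the squared distance of optima, and reward classes are at most `C`
  -- times that distance apart.
  refine ⟨η / C ^ 2, by positivity, fun r hr r' hr' μ hμ => ?_⟩
  rw [optOcc_eq_singleton hη hconv (hf r) (hfpos r) (hfstat r), Set.mem_singleton_iff] at hμ
  subst hμ
  refine le_trans ?_ (hconv.le_subOpt hη (hf r') (hfpos r') (hfstat r') (hf r))
  have h1 : ‖(potentialShaping γ P).mkQ r - (potentialShaping γ P).mkQ r'‖ ≤ C * ‖f r - f r'‖ := by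
    refine (Submodule.norm_mkQ_sub_le (x := gradient (occReg h) (f r) - gradient (occReg h) (f r'))
      _ ?_).trans (hCle _ (hKmem hr) _ (hKmem hr'))
    -- Subtracting the stationarity conditions shows that `r - r'` and the difference of gradients
    -- agree modulo `𝒰_P`.
    have h2 := Submodule.sub_mem _ (hfstat r) (hfstat r')
    rwa [sub_sub_sub_comm] at h2
  have h3 := mul_le_mul_of_nonneg_left (pow_le_pow_left₀ (norm_nonneg _) h1 2)
    (by positivity : 0 ≤ η / C ^ 2 / 2)
  refine h3.trans (le_of_eq ?_)
  field_simp

theorem IsDualConvexityConst.mono {R : Set (EuclideanSpace ℝ (S × A))} {σ τ : ℝ}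
    (hσ : IsDualConvexityConst γ ν₀ h R P σ) (hle : τ ≤ σ) :
    IsDualConvexityConst γ ν₀ h R P τ := by
  intro r hr r' hr' μ hμ
  refine le_trans ?_ (hσ r hr r' hr' μ hμ)
  exact mul_le_mul_of_nonneg_right (by linarith) (sq_nonneg _)

theorem IsDualConvexityConst.norm_sub_starProjection_sq_le
    {R : Set (EuclideanSpace ℝ (S × A))} {σ ε : ℝ} (hσ0 : 0 < σ)
    (hσ : IsDualConvexityConst γ ν₀ h R P σ) {r r' : EuclideanSpace ℝ (S × A)} (hr : r ∈ R)
    (hr' : r' ∈ R) {μ : EuclideanSpace ℝ (S × A)} (hμ : μ ∈ optOcc γ ν₀ h P r)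
    (hε : subOpt γ ν₀ h P r' μ ≤ ε) :
    ‖r - r' - (potentialShaping γ P).starProjection (r - r')‖ ^ 2 ≤ 2 * ε / σ := by
  have h1 := (hσ r hr r' hr' μ hμ).trans hε
  rw [← map_sub] at h1
  have h2 := pow_le_pow_left₀ (norm_nonneg _)
    ((potentialShaping γ P).norm_sub_starProjection_le_norm_mkQ (r - r')) 2
  refine h2.trans ?_
  rw [le_div_iff₀ hσ0]
  linarith

end Transfer

theorem theorem1 {S A : Type*} [Fintype S] [Nontrivial S] [Fintype A] [Nontrivial A]
    (γ : ℝ) (hγ0 : 0 < γ) (hγ1 : γ < 1) (ν₀ : stdSimplex ℝ S)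
    (X : Set (EuclideanSpace ℝ A)) (h : EuclideanSpace ℝ A → ℝ)
    (hreg : IsRegularizer X h) (hsteep : IsSteep X h)
    (hexp : ∀ P : TransitionLaw S A, Exploration γ ν₀ P)
    (η : ℝ) (hη : 0 < η)
    (hconv : ∀ P : TransitionLaw S A, OccStronglyConvex γ ν₀ h η P)
    (hlip : ∀ P : TransitionLaw S A, OccLocallyLipschitzGradient γ ν₀ h P)
    (R : Set (EuclideanSpace ℝ (S × A))) (hR : IsCompact R)
    (P : Fin 2 → TransitionLaw S A)
    (hθ : 0 < principalAngle (potentialShaping γ (P 0)) (potentialShaping γ (P 1)) 2) :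
    (∃ σ : ℝ, 0 < σ ∧ ∀ k, IsDualConvexityConst γ ν₀ h R (P k) σ) ∧
    ∀ σ : ℝ, 0 < σ → (∀ k, IsDualConvexityConst γ ν₀ h R (P k) σ) →
      ∀ rE ∈ R, ∀ rhat ∈ R, ∀ μE : Fin 2 → EuclideanSpace ℝ (S × A),
        (∀ k, μE k ∈ optOcc γ ν₀ h (P k) rE) →
        ∀ εhat : ℝ, (∀ k, subOpt γ ν₀ h (P k) rhat (μE k) ≤ εhat) →
          IsTransferable γ ν₀ h rE rhat
            (εhat / (η * σ * Real.sin
              (principalAngle (potentialShaping γ (P 0)) (potentialShaping γ (P 1)) 2 / 2) ^ 2))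
            Set.univ := by
  constructor
  · choose σ hσ0 hσ using fun k => exists_isDualConvexityConst hγ0 hγ1 hreg hsteep (hexp (P k)) hη
      (hconv (P k)) (hlip (P k)) hR
    refine ⟨min (σ 0) (σ 1), lt_min (hσ0 0) (hσ0 1), Fin.forall_fin_two.2 ⟨?_, ?_⟩⟩
    · exact (hσ 0).mono (min_le_left _ _)
    · exact (hσ 1).mono (min_le_right _ _)
  · intro σ hσ0 hσ rE hrE rhat hrhat μE hμE ε hε Q _
    obtain ⟨μ, hμ, hpos, hstat⟩ :=
      exists_stationary_occMeasure hγ0 hγ1 hreg hsteep (hexp Q) hη (hconv Q) rhat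
    refine ⟨μ, optOcc_eq_singleton hη (hconv Q) hμ hpos hstat, ?_⟩
    obtain ⟨e, he, hemem⟩ := exists_unit_mem_potentialShaping (S := S) (A := A) hγ1
    set θ := principalAngle (potentialShaping γ (P 0)) (potentialShaping γ (P 1)) 2 with hθdef
    set z := (ℝ ∙ e).starProjection (rE - rhat) with hz
    have hzQ : z ∈ potentialShaping γ Q :=
      (Submodule.span_singleton_le_iff_mem _ _).2 (hemem Q) (Submodule.starProjection_apply_mem _ _)
    -- Modulo `𝒰_Q`, the reward difference may be replaced by its part orthogonal to the constants,
    -- which does not depend on `Q`.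
    refine ((hconv Q).subOpt_le hη hμ hpos hstat (x := rE - rhat - z)
      (by rwa [sub_sub_cancel])).trans ?_
    have hsin : 0 < Real.sin (θ / 2) := by
      refine Real.sin_pos_of_pos_of_lt_pi (by linarith) ?_
      have h1 : θ ≤ Real.pi := Real.arccos_le_pi _
      linarith [Real.pi_pos]
    have hangle := norm_sub_starProjection_mul_sin_le hθ (hemem (P 0)) (hemem (P 1)) he (rE - rhat)
    have hk (k : Fin 2) := (hσ k).norm_sub_starProjection_sq_le hσ0 hrE hrhat (hμE k) (hε k)
    have hsq : (‖rE - rhat - z‖ * Real.sin (θ / 2)) ^ 2 ≤ 2 * ε / σ := by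
      have h0 : 0 ≤ ‖rE - rhat - z‖ * Real.sin (θ / 2) := mul_nonneg (norm_nonneg _) hsin.le
      rcases le_max_iff.1 hangle with h1 | h1
      · exact (pow_le_pow_left₀ h0 h1 2).trans (hk 0)
      · exact (pow_le_pow_left₀ h0 h1 2).trans (hk 1)
    -- The factor 2 in the squared distance bound `2 * ε / σ` cancels that of `‖x‖ ^ 2 / (2 * η)`.
    rw [le_div_iff₀ hσ0, mul_pow] at hsq
    rw [div_le_div_iff₀ (by positivity) (by positivity)]
    nlinarith [mul_le_mul_of_nonneg_left hsq hη.le]
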